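/- Let $\mathbb{D}$ be the open unit disk. For functions $g,F$ on $\mathbb{D}$ write $g\prec F$ if $g=F\circ w$ for some analytic $w:\mathbb{D}\to\mathbb{D}$ with $w(0)=0$. Let $-1\le E<D\le 1$ and $\psi(z)=(1+Dz)/(1+Ez)$. Let $\mathcal{S}^*(\psi)$ be the class of analytic $f(z)=z+\sum_{n\ge 2}a_nz^n$ on $\mathbb{D}$ with $zf'(z)/f(z)\prec\psi(z)$, and for $f\in\mathcal{S}^*(\psi)$ let $S_f(\psi)$ be the class of analytic $g(z)=\sum_{k\ge 1}b_kz^k$ on $\mathbb{D}$ with $g\prec f$. For $0<\rho\le 1$ say that the classes $S_f(\psi)$ satisfy the Bohr phenomenon for $r\le\rho$ if $$\sum_{k=1}^{\infty}|b_k|r^k\le d\big(f(0),\partial f(\mathbb{D})\big)\qquad\text{for all } f\in\mathcal{S}^*(\psi),\ g=\sum_{k\ge1} b_kz^k\in S_f(\psi),\ 0\le r\le\rho,\ r<1,$$ and that $\mathcal{S}^*(\psi)$ does if $r+\sum_{n\ge2}|a_n|r^n\le d(f(0),\partial f(\mathbb{D}))$ for all $f\in\mathcal{S}^*(\psi)$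 and all such $r$; here $d$ is Euclidean distance. Put $$f_0(z)=z(1+Ez)^{\frac{D-E}{E}}\ \ (E\ne0,\text{ principal branch}),\qquad f_0(z)=ze^{Dz}\ \ (E=0),$$ and $f_0(z)=z+\sum_{n\ge2}t_nz^n$. (i) If $E=0$ and $D\ge\frac34\log 3$, then the equation $1-re^{D(1+r)}=0$ has exactly one real root $r_0$, and $r_0\in(0,1)$. (ii) If $E\neq0$, $t_n\ge0$ for all $n\ge2$, and $3(1-E)^{\frac{D-E}{E}}\le(1+E/3)^{\frac{D-E}{E}}$, then the equation $(1-E)^{\frac{D-E}{E}}-r(1+Er)^{\frac{D-E}{E}}=0$ has exactly one root $r_0$ among the real $r$ with $1+Er>0$, and $r_0\in(0,1)$. In both cases the classes $S_f(\psi)$, and also $\mathcal{S}^*(\psi)$, satisfy the Bohr phenomenon for $r\le r_0$. The result is sharp: in both instances $r_0$ is the largest number in $(0,1]$ with this property. Moreover $f_0\in\mathcal{S}^*(\psi)$, and for $f=g=f_0$ the inequality is an equality at $r=r_0$ and fails for every $r\in(r_0,1)$. -/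

import Mathlib

namespace JanowskiBohr

/-- The open unit disk. -/
abbrev unitDisk : Set ℂ := Metric.ball (0 : ℂ) 1

/-- `g ≺ F` on the unit disk: `g = F ∘ w` on the disk for some analytic self-map `w` of the disk
with `w 0 = 0`. Functions on the disk are represented by functions on `ℂ`, and their
values outside the disk are irrelevant. -/
def Subordinate (g F : ℂ → ℂ) : Prop :=
  ∃ w : ℂ → ℂ, DifferentiableOn ℂ w unitDisk ∧ w 0 = 0 ∧
    (∀ z ∈ unitDisk, w z ∈ unitDisk) ∧ ∀ z ∈ unitDisk, g z = F (w z)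

/-- The class of functions analytic in the disk of the form `z + a₂ z² + ⋯`. -/
def classA : Set (ℂ → ℂ) :=
  {f | DifferentiableOn ℂ f unitDisk ∧ f 0 = 0 ∧ deriv f 0 = 1}

open Classical in
/-- The function `z f'(z) / f(z)`, with its removable singularity at the origin filled in
(for `f` in `classA` the limit at `0` is `1`). -/
noncomputable def logDerivQuotient (f : ℂ → ℂ) (z : ℂ) : ℂ :=
  if z = 0 then 1 else z * deriv f z / f z

/-- The Ma-Minda class `S*(ψ)`: those `f` in `classA` for which `z f'(z) / f(z)` is an analytic
function on the disk (so `f` has no zero other than the origin) subordinate to `ψ`. -/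
def starlikeClass (ψ : ℂ → ℂ) : Set (ℂ → ℂ) :=
  {f | f ∈ classA ∧ (∀ z ∈ unitDisk, z ≠ 0 → f z ≠ 0) ∧ Subordinate (logDerivQuotient f) ψ}

/-- The class `S_f(ψ)` of analytic functions on the disk subordinate to a given
`f ∈ S*(ψ)`. As `f 0 = 0`, its members have the form `b₁ z + b₂ z² + ⋯`. -/
def subordinants (f : ℂ → ℂ) : Set (ℂ → ℂ) :=
  {g | DifferentiableOn ℂ g unitDisk ∧ Subordinate g f}

/-- The `k`-th Taylor coefficient at the origin. -/
noncomputable def taylorCoeff (g : ℂ → ℂ) (k : ℕ) : ℂ :=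
  iteratedDeriv k g 0 / (k.factorial : ℂ)

/-- The majorant series `∑_{k ≥ 1} |b_k| r ^ k` of `g = ∑ b_k z ^ k`, as a real number. -/
noncomputable def majorant (g : ℂ → ℂ) (r : ℝ) : ℝ :=
  ∑' k : ℕ, ‖taylorCoeff g (k + 1)‖ * r ^ (k + 1)

/-- The Euclidean distance from `f 0` to the boundary of the image of the disk under `f`. -/
noncomputable def boundaryDist (f : ℂ → ℂ) : ℝ :=
  Metric.infDist (f 0) (frontier (f '' unitDisk))

/-- The family `𝒢` satisfies the Bohr phenomenon relative to `f` for `|z| = r ≤ ρ`: for each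
`g ∈ 𝒢` the majorant series converges and is at most `d(f(0), ∂ f(𝔻))`. -/
def BohrPhenomenon (f : ℂ → ℂ) (𝒢 : Set (ℂ → ℂ)) (ρ : ℝ) : Prop :=
  ∀ g ∈ 𝒢, ∀ z ∈ unitDisk, ‖z‖ ≤ ρ →
    Summable (fun k : ℕ => ‖taylorCoeff g (k + 1)‖ * ‖z‖ ^ (k + 1)) ∧
      majorant g ‖z‖ ≤ boundaryDist f

/-- The Janowski function `(1 + D z) / (1 + E z)`. -/
noncomputable def janowskiPsi (D E : ℝ) (z : ℂ) : ℂ :=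
  (1 + (D : ℂ) * z) / (1 + (E : ℂ) * z)

open Classical in
/-- The function `f₀` of the Janowski class. The power is the principal one; on the unit
disk `1 + E z` lies in the right half-plane when `|E| ≤ 1`. -/
noncomputable def janowskiExtremal (D E : ℝ) (z : ℂ) : ℂ :=
  if E = 0 then z * Complex.exp ((D : ℂ) * z)
  else z * (1 + (E : ℂ) * z) ^ (((D - E) / E : ℝ) : ℂ)

/-- For `f ∈ S*(ψ)`, both `S_f(ψ)` and `S*(ψ)` satisfy the Bohr phenomenon for `r ≤ r₀`, and
`r₀` is the largest radius in `(0, 1]` with that property (the Bohr radius), in each of the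
two cases; moreover `f₀ ∈ S*(ψ)` is extremal: with `f = g = f₀` the inequality is an equality
at `r₀` and fails at every `r ∈ (r₀, 1)`. -/
def SharpBohr (ψ f₀ : ℂ → ℂ) (r₀ : ℝ) : Prop :=
  IsGreatest {ρ : ℝ | ρ ∈ Set.Ioc (0 : ℝ) 1 ∧
    ∀ f ∈ starlikeClass ψ, BohrPhenomenon f (subordinants f) ρ} r₀ ∧
  IsGreatest {ρ : ℝ | ρ ∈ Set.Ioc (0 : ℝ) 1 ∧
    ∀ f ∈ starlikeClass ψ, BohrPhenomenon f {f} ρ} r₀ ∧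
  f₀ ∈ starlikeClass ψ ∧
  majorant f₀ r₀ = boundaryDist f₀ ∧
  ∀ r ∈ Set.Ioo r₀ 1, boundaryDist f₀ < majorant f₀ r

end JanowskiBohr

namespace JanowskiBohr

open Complex Metric Filter Topology

/-! Write `f₀(z) = z H(z)`. The core fact is that every `f` in the class equals `z H(v(z))` for some
Schwarz function `v` (`exists_eq_mul_exp_extremalLog`): `v` solves a separable equation, and Jack's
lemma keeps it inside the disk.

The factorization is used twice. The minimum principle for `|H|`, made explicit, gives `|f(z)| ≥ |z|
(-f₀(-1))`; as `f` is univalent, its image is open and not the plane, so `d(f(0), ∂f(𝔻)) ≥ -f₀(-1)`.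
On the other side, for `r ≤ 1/3` composing with a Schwarz function does not increase the majorant
(`fullMajorant_comp_le`, a consequence of Bohr's theorem). Applied to `g = f ∘ w` and to `H ∘ v`,
this bounds the majorant of `g` by that of `f`, and that of `f` by that of `f₀`.

If the coefficients of `f₀` are nonnegative, its majorant is `f₀(r)`, which increases. The numerical
hypothesis says `-f₀(-1) ≤ f₀(1/3)`, so the root of `f₀(r) = -f₀(-1)` lies in the range `r ≤ 1/3`.
Sharpness holds because `f₀` itself has boundary distance exactly `-f₀(-1)`. -/

/-! ### Carathéodory's coefficient bound. -/

theorem circleAverage_inv_pow_mul {P : ℂ → ℂ} (hP : DifferentiableOn ℂ P unitDisk) {R : ℝ}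
    (hR : 0 < R) (hR1 : R < 1) (k : ℕ) :
    Real.circleAverage (fun z => (z ^ k)⁻¹ * P z) 0 R = taylorCoeff P k := by
  have hd : DiffContOnCl ℂ P (ball 0 R) :=
    (hP.mono (by
      rw [closure_ball _ hR.ne']
      exact closedBall_subset_ball hR1)).diffContOnCl
  have h := hd.circleIntegral_one_div_sub_center_pow_smul hR k
  rw [Real.circleAverage_eq_circleIntegral hR.ne', taylorCoeff]
  have e : (∮ z in C(0, R), (z - 0)⁻¹ • ((z ^ k)⁻¹ * P z)) =
      ∮ z in C(0, R), (1 / (z - 0) ^ (k + 1)) • P z := by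
    congr 1
    ext z
    simp only [sub_zero, smul_eq_mul, pow_succ, one_div, mul_inv]
    ring
  rw [e, h, smul_smul, smul_eq_mul]
  field_simp

/-- On `|z| = R` the mean of `z ^ k * P` vanishes, so adding a multiple of its conjugate turns the
`k`-th coefficient of `P` into a Fourier coefficient of `2 Re P ≥ 0`. Its modulus is at most `R ^
(-k)` times the mean `2 Re P(0)`; then `R → 1`. -/
theorem norm_taylorCoeff_le_of_re_nonneg {P : ℂ → ℂ} (hP : DifferentiableOn ℂ P unitDisk)
    (hre : ∀ z ∈ unitDisk, 0 ≤ (P z).re) {k : ℕ} (hk : k ≠ 0) :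
    ‖taylorCoeff P k‖ ≤ 2 * (P 0).re := by
  have main : ∀ R : ℝ, 0 < R → R < 1 → R ^ k * ‖taylorCoeff P k‖ ≤ 2 * (P 0).re := by
    intro R hR hR1
    have hsub : closedBall (0 : ℂ) R ⊆ unitDisk := closedBall_subset_ball hR1
    have hsph : sphere (0 : ℂ) |R| ⊆ unitDisk := by
      rw [abs_of_pos hR]; exact sphere_subset_closedBall.trans hsub
    have hne : ∀ z ∈ sphere (0 : ℂ) |R|, z ≠ 0 := by
      rintro z hz rfl
      simp only [mem_sphere_iff_norm, sub_self, norm_zero] at hz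
      exact (abs_pos.2 hR.ne').ne hz
    have hd : DiffContOnCl ℂ P (ball 0 |R|) := by
      refine (hP.mono ?_).diffContOnCl
      rw [abs_of_pos hR, closure_ball _ hR.ne']
      exact hsub
    have hPc : ContinuousOn P (sphere 0 |R|) := (hP.mono hsph).continuousOn
    have hinv : ContinuousOn (fun z : ℂ => (z ^ k)⁻¹) (sphere 0 |R|) :=
      (continuous_pow k).continuousOn.inv₀ fun z hz => pow_ne_zero _ (hne z hz)
    have h1 := circleAverage_inv_pow_mul hP hR hR1 k
    have h2 : Real.circleAverage (fun z => z ^ k * P z) 0 R = 0 := by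
      have : DiffContOnCl ℂ (fun z => z ^ k * P z) (ball 0 |R|) :=
        ((differentiable_pow k).diffContOnCl).smul hd
      rw [this.circleAverage]
      simp [hk]
    have h0 : Real.circleAverage P 0 R = P 0 := hd.circleAverage
    have i1 : CircleIntegrable (fun z => (z ^ k)⁻¹ * P z) 0 R :=
      (hinv.mul hPc).circleIntegrable'
    have i2 : CircleIntegrable (fun z => z ^ k * P z) 0 R :=
      ((continuous_pow k).continuousOn.mul hPc).circleIntegrable'
    have i0 : CircleIntegrable P 0 R := hPc.circleIntegrable'
    have h3 : Real.circleAverage (fun z => (starRingEnd ℂ) (z ^ k * P z)) 0 R = 0 := by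
      have := (conjCLE : ℂ →L[ℝ] ℂ).circleAverage_comp_comm i2
      rw [h2, map_zero] at this
      exact this
    have h4 : taylorCoeff P k =
        Real.circleAverage (fun z => (z ^ k)⁻¹ * ((2 * (P z).re : ℝ) : ℂ)) 0 R := by
      have e : Set.EqOn (fun z => (z ^ k)⁻¹ * ((2 * (P z).re : ℝ) : ℂ))
          (fun z => (z ^ k)⁻¹ * P z +
            (((R ^ 2) ^ k)⁻¹ : ℝ) • (starRingEnd ℂ) (z ^ k * P z)) (sphere 0 |R|) := by
        intro z hz
        have hz0 := hne z hz
        -- On this circle conjugation is inversion, which is where the factor `((R ^ 2) ^ k)⁻¹`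
        -- comes from.
        have hc : (starRingEnd ℂ) z = (R : ℂ) ^ 2 * z⁻¹ := by
          have hzR : ‖z‖ = R := by simpa [abs_of_pos hR] using hz
          rw [eq_mul_inv_iff_mul_eq₀ hz0, mul_comm, mul_conj, normSq_eq_norm_sq, hzR]
          norm_cast
        have hPP : ((2 * (P z).re : ℝ) : ℂ) = P z + (starRingEnd ℂ) (P z) := by
          rw [add_conj]
        have hRC : (R : ℂ) ≠ 0 := by exact_mod_cast hR.ne'
        simp only [map_mul, map_pow, hc, hPP, real_smul, mul_pow, inv_pow]
        push_cast
        field_simp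
      have i4 : CircleIntegrable
          (fun z => (((R ^ 2) ^ k)⁻¹ : ℝ) • (starRingEnd ℂ) (z ^ k * P z)) 0 R :=
        ContinuousOn.circleIntegrable' <| ContinuousOn.const_smul (continuous_conj.comp_continuousOn
          ((continuous_pow k).continuousOn.mul hPc)) ((R ^ 2) ^ k)⁻¹
      rw [Real.circleAverage_congr_sphere e, Real.circleAverage_fun_add i1 i4, h1, Real.circleAverage_fun_smul, h3]
      simp
    have h5 : 2 * (P 0).re = Real.circleAverage (fun z => 2 * (P z).re) 0 R := by
      have := (reCLM : ℂ →L[ℝ] ℝ).circleAverage_comp_comm i0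
      rw [h0] at this
      have t := Real.circleAverage_fun_smul (a := (2 : ℝ)) (f := fun z => (P z).re) (c := 0) (R := R)
      simp only [smul_eq_mul] at t
      rw [t]
      congr 1
      exact this.symm
    rw [h4, h5, Real.circleAverage_def, Real.circleAverage_def, norm_smul, smul_eq_mul,
      mul_left_comm]
    have hpi : 0 < 2 * Real.pi := by positivity
    rw [Real.norm_of_nonneg (by positivity : 0 ≤ (2 * Real.pi)⁻¹)]
    refine mul_le_mul_of_nonneg_left ?_ (by positivity)
    rw [← le_div_iff₀' (by positivity)]
    refine (intervalIntegral.norm_integral_le_integral_norm hpi.le).trans_eq ?_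
    rw [← intervalIntegral.integral_div]
    refine intervalIntegral.integral_congr fun θ _ => ?_
    have hm : circleMap 0 R θ ∈ unitDisk := hsub (circleMap_mem_closedBall 0 hR.le θ)
    have hn : 0 ≤ 2 * (P (circleMap 0 R θ)).re := by linarith [hre _ hm]
    have hrr : ‖(((2 * (P (circleMap 0 R θ)).re : ℝ)) : ℂ)‖ = 2 * (P (circleMap 0 R θ)).re := by
      rw [norm_real, Real.norm_of_nonneg hn]
    simp only [norm_mul, norm_inv, norm_pow, hrr] at *
    rw [norm_circleMap_zero, abs_of_pos hR]
    ring
  have ht : Filter.Tendsto (fun R : ℝ => R ^ k * ‖taylorCoeff P k‖) (nhdsWithin 1 (Set.Iio 1))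
      (nhds (1 ^ k * ‖taylorCoeff P k‖)) :=
    (Continuous.tendsto (by fun_prop) 1).mono_left nhdsWithin_le_nhds
  rw [one_pow, one_mul] at ht
  refine le_of_tendsto ht ?_
  filter_upwards [Ioo_mem_nhdsLT (zero_lt_one (α := ℝ))] with R hR using main R hR.1 hR.2

/-! ### Majorant series, Bohr's theorem and subordination. -/

theorem hasSum_iff_of_forall_eq {f g : ℕ → ℂ} {a : ℂ} (h : ∀ k, f k = g k) :
    HasSum f a ↔ HasSum g a := by rw [funext h]

theorem differentiableOn_mul_id {G : ℂ → ℂ} (hG : DifferentiableOn ℂ G unitDisk) :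
    DifferentiableOn ℂ (fun z => z * G z) unitDisk := differentiableOn_id.mul hG

theorem differentiableOn_fun_pow {G : ℂ → ℂ} (hG : DifferentiableOn ℂ G unitDisk) (n : ℕ) :
    DifferentiableOn ℂ (fun z => G z ^ n) unitDisk := hG.pow n

theorem hasSum_taylorCoeff {F : ℂ → ℂ} (hF : DifferentiableOn ℂ F unitDisk) {z : ℂ}
    (hz : z ∈ unitDisk) : HasSum (fun k => taylorCoeff F k * z ^ k) (F z) := by
  have h := hasSum_taylorSeries_on_ball hF hz
  simp only [sub_zero, smul_eq_mul] at h
  refine (hasSum_iff_of_forall_eq ?_).mpr (h)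
  intro k
  simp only [taylorCoeff, div_eq_mul_inv]
  ring

theorem summable_norm_taylorCoeff {F : ℂ → ℂ} (hF : DifferentiableOn ℂ F unitDisk) {r : ℝ}
    (h0 : 0 ≤ r) (h1 : r < 1) : Summable (fun k => ‖taylorCoeff F k‖ * r ^ k) := by
  have hr : (r : ℂ) ∈ unitDisk := by simpa [abs_of_nonneg h0] using h1
  have h := (hasSum_taylorCoeff hF hr).summable.norm
  simpa [abs_of_nonneg h0] using h

theorem taylorCoeff_eq_of_hasSum {F : ℂ → ℂ} (hF : DifferentiableOn ℂ F unitDisk) {c : ℕ → ℂ}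
    {ρ : ℝ} (hρ : 0 < ρ) (h : ∀ z, ‖z‖ < ρ → HasSum (fun k => c k * z ^ k) (F z)) (k : ℕ) :
    taylorCoeff F k = c k := by
  have key : ∀ (d : ℕ → ℂ) {σ : ℝ}, 0 < σ →
      (∀ z, ‖z‖ < σ → HasSum (fun k => d k * z ^ k) (F z)) →
      HasFPowerSeriesAt F (FormalMultilinearSeries.ofScalars ℂ d) 0 := by
    intro d σ hσ hd
    rw [hasFPowerSeriesAt_iff]
    filter_upwards [ball_mem_nhds (0 : ℂ) hσ] with z hz
    have := hd z (by simpa using hz)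
    simpa [FormalMultilinearSeries.coeff_ofScalars, mul_comm] using this
  have h1 := key (taylorCoeff F) one_pos fun z hz => hasSum_taylorCoeff hF (by simpa using hz)
  have h2 := key c hρ h
  have := congrArg (fun p => p.coeff k) (h1.eq_formalMultilinearSeries h2)
  simpa [FormalMultilinearSeries.coeff_ofScalars] using this

theorem taylorCoeff_zero (F : ℂ → ℂ) : taylorCoeff F 0 = F 0 := by
  simp [taylorCoeff]

/-- The full majorant series, including the constant term. -/
noncomputable def fullMajorant (F : ℂ → ℂ) (r : ℝ) : ℝ := ∑' k : ℕ, ‖taylorCoeff F k‖ * r ^ k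

theorem fullMajorant_eq_norm_add_majorant {F : ℂ → ℂ} (hF : DifferentiableOn ℂ F unitDisk) {r : ℝ}
    (h0 : 0 ≤ r) (h1 : r < 1) : fullMajorant F r = ‖F 0‖ + majorant F r := by
  rw [fullMajorant, (summable_norm_taylorCoeff hF h0 h1).tsum_eq_zero_add, taylorCoeff_zero,
    majorant]
  simp

theorem differentiableOn_congr {F G : ℂ → ℂ} (h : DifferentiableOn ℂ F unitDisk)
    (e : ∀ z ∈ unitDisk, F z = G z) : DifferentiableOn ℂ G unitDisk :=
  h.congr fun z hz => (e z hz).symm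

theorem taylorCoeff_congr {F G : ℂ → ℂ} (hF : DifferentiableOn ℂ F unitDisk)
    (e : ∀ z ∈ unitDisk, F z = G z) (k : ℕ) : taylorCoeff F k = taylorCoeff G k := by
  refine taylorCoeff_eq_of_hasSum hF one_pos (fun z hz => ?_) k
  have hz' : z ∈ unitDisk := by simpa using hz
  rw [e z hz']
  exact hasSum_taylorCoeff (differentiableOn_congr hF e) hz'

theorem fullMajorant_congr {F G : ℂ → ℂ} (hF : DifferentiableOn ℂ F unitDisk)
    (e : ∀ z ∈ unitDisk, F z = G z) (r : ℝ) : fullMajorant F r = fullMajorant G r := by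
  simp only [fullMajorant, taylorCoeff_congr hF e]

/-- **Bohr's theorem** for functions bounded by one. -/
theorem fullMajorant_le_one {F : ℂ → ℂ} (hF : DifferentiableOn ℂ F unitDisk)
    (hb : ∀ z ∈ unitDisk, ‖F z‖ ≤ 1) {r : ℝ} (h0 : 0 ≤ r) (hr : r ≤ 1 / 3) :
    fullMajorant F r ≤ 1 := by
  -- The rotation makes `1 - u F` a function of nonnegative real part with value `1 - |F(0)|` at the
  -- origin.
  obtain ⟨u, hu, huF⟩ : ∃ u : ℂ, ‖u‖ = 1 ∧ u * F 0 = (‖F 0‖ : ℂ) := by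
    rcases eq_or_ne (F 0) 0 with h | h
    · exact ⟨1, by simp, by simp [h]⟩
    · refine ⟨‖F 0‖ / F 0, ?_, by field_simp⟩
      simp [h]
  have hP : DifferentiableOn ℂ (fun z => 1 - u * F z) unitDisk :=
    (differentiableOn_const 1).sub (hF.const_mul u)
  have hcoef : ∀ k, k ≠ 0 → ‖taylorCoeff F k‖ ≤ 2 * (1 - ‖F 0‖) := by
    intro k hk
    have hc : taylorCoeff (fun z => 1 - u * F z) k =
        (if k = 0 then 1 else 0) - u * taylorCoeff F k := by
      refine taylorCoeff_eq_of_hasSum (c := fun k => (if k = 0 then 1 else 0) - u * taylorCoeff F k)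
        hP one_pos (fun z hz => ?_) k
      have h1 : HasSum (fun k : ℕ => (if k = 0 then (1 : ℂ) else 0) * z ^ k) 1 := by
        have := hasSum_ite_eq (0 : ℕ) (1 : ℂ)
        refine (hasSum_iff_of_forall_eq ?_).mpr (this)
        rintro (_ | k) <;> simp
      have h2 := (hasSum_taylorCoeff hF (z := z) (by simpa using hz)).mul_left u
      refine (hasSum_iff_of_forall_eq ?_).mpr ((h1.sub h2))
      intro k
      ring
    have hre : ∀ z ∈ unitDisk, 0 ≤ (1 - u * F z).re := by
      intro z hz
      have : (u * F z).re ≤ 1 :=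
        (re_le_norm _).trans (by rw [norm_mul, hu, one_mul]; exact hb z hz)
      simpa using this
    have := norm_taylorCoeff_le_of_re_nonneg hP hre hk
    simpa [hc, hk, hu, huF] using this
  have hs := summable_norm_taylorCoeff hF h0 (by linarith)
  rw [fullMajorant_eq_norm_add_majorant hF h0 (by linarith), majorant]
  -- The radius `1/3` is the one at which `2 ∑ r ^ (k + 1)` equals `1`.
  have hg : HasSum (fun k : ℕ => 2 * (1 - ‖F 0‖) * (1 / 3 : ℝ) ^ (k + 1)) (1 - ‖F 0‖) := by
    have := (hasSum_geometric_of_lt_one (r := (1 / 3 : ℝ)) (by norm_num) (by norm_num)).mul_left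
      (2 * (1 - ‖F 0‖) * (1 / 3))
    rw [show 2 * (1 - ‖F 0‖) * (1 / 3) * (1 - 1 / 3 : ℝ)⁻¹ = 1 - ‖F 0‖ by norm_num; ring] at this
    simpa only [pow_succ', mul_assoc] using this
  have : ∑' k : ℕ, ‖taylorCoeff F (k + 1)‖ * r ^ (k + 1) ≤ 1 - ‖F 0‖ := by
    rw [← hg.tsum_eq]
    refine ((summable_nat_add_iff 1).2 hs).tsum_le_tsum (fun k => ?_) hg.summable
    exact mul_le_mul (hcoef _ k.succ_ne_zero) (pow_le_pow_left₀ h0 hr _) (by positivity)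
      ((norm_nonneg _).trans (hcoef _ k.succ_ne_zero))
  linarith

theorem taylorCoeff_mul_id {G : ℂ → ℂ} (hG : DifferentiableOn ℂ G unitDisk) (k : ℕ) :
    taylorCoeff (fun z => z * G z) k = if k = 0 then 0 else taylorCoeff G (k - 1) := by
  refine taylorCoeff_eq_of_hasSum (c := fun k => if k = 0 then 0 else taylorCoeff G (k - 1))
    (differentiableOn_mul_id hG) one_pos (fun z hz => ?_) k
  have := (hasSum_taylorCoeff hG (z := z) (by simpa using hz)).mul_left z
  rw [← hasSum_nat_add_iff' 1]
  simpa [pow_succ', mul_left_comm] using this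

theorem taylorCoeff_mul_id_succ {G : ℂ → ℂ} (hG : DifferentiableOn ℂ G unitDisk) (k : ℕ) :
    taylorCoeff (fun z => z * G z) (k + 1) = taylorCoeff G k := by
  simp [taylorCoeff_mul_id hG]

theorem majorant_mul_id {G : ℂ → ℂ} (hG : DifferentiableOn ℂ G unitDisk) (r : ℝ) :
    majorant (fun z => z * G z) r = r * fullMajorant G r := by
  rw [majorant, fullMajorant, ← tsum_mul_left]
  refine tsum_congr fun k => ?_
  rw [taylorCoeff_mul_id_succ hG]
  ring

theorem fullMajorant_mul_id {G : ℂ → ℂ} (hG : DifferentiableOn ℂ G unitDisk) {r : ℝ}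
    (h0 : 0 ≤ r) (h1 : r < 1) :
    fullMajorant (fun z => z * G z) r = r * fullMajorant G r := by
  rw [fullMajorant_eq_norm_add_majorant (differentiableOn_mul_id hG) h0 h1, majorant_mul_id hG]
  simp

theorem fullMajorant_pow_mul {G : ℂ → ℂ} (hG : DifferentiableOn ℂ G unitDisk) {r : ℝ}
    (h0 : 0 ≤ r) (h1 : r < 1) (n : ℕ) :
    fullMajorant (fun z => z ^ n * G z) r = r ^ n * fullMajorant G r := by
  induction n with
  | zero => simp
  | succ n ih =>
    have := fullMajorant_mul_id (G := fun z => z ^ n * G z)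
      (((differentiable_pow n).differentiableOn).mul hG) h0 h1
    rw [ih, ← mul_assoc, ← pow_succ'] at this
    simpa only [pow_succ', mul_assoc] using this

theorem differentiableOn_dslope_zero {w : ℂ → ℂ} (hw : DifferentiableOn ℂ w unitDisk) :
    DifferentiableOn ℂ (dslope w 0) unitDisk :=
  (differentiableOn_dslope (isOpen_ball.mem_nhds (by simp))).2 hw

theorem mul_dslope_zero {w : ℂ → ℂ} (h0 : w 0 = 0) (z : ℂ) : z * dslope w 0 z = w z := by
  simpa [h0] using sub_smul_dslope w 0 z

theorem norm_dslope_zero_le_one {w : ℂ → ℂ} (hw : DifferentiableOn ℂ w unitDisk) (h0 : w 0 = 0)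
    (hm : ∀ z ∈ unitDisk, w z ∈ unitDisk) {z : ℂ} (hz : z ∈ unitDisk) : ‖dslope w 0 z‖ ≤ 1 := by
  have := norm_dslope_le_div_of_mapsTo_ball (R₂ := 1) hw
    (fun x hx => by rw [h0]; exact ball_subset_closedBall (hm x hx)) hz
  simpa using this

/-- By Schwarz `w(z)/z` is bounded by one, so Bohr's theorem applies to its `n`-th power; the factor
`z ^ n` contributes exactly `r ^ n`. -/
theorem fullMajorant_schwarz_pow_le {w : ℂ → ℂ} (hw : DifferentiableOn ℂ w unitDisk) (h0 : w 0 = 0)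
    (hm : ∀ z ∈ unitDisk, w z ∈ unitDisk) {r : ℝ} (hr0 : 0 ≤ r) (hr : r ≤ 1 / 3) (n : ℕ) :
    fullMajorant (fun z => w z ^ n) r ≤ r ^ n := by
  have hW := differentiableOn_fun_pow (differentiableOn_dslope_zero hw) n
  have e : ∀ z ∈ unitDisk, w z ^ n = z ^ n * dslope w 0 z ^ n := fun z _ => by
    rw [← mul_pow, mul_dslope_zero h0]
  rw [fullMajorant_congr (differentiableOn_fun_pow hw n) e, fullMajorant_pow_mul hW hr0 (by linarith)]
  refine mul_le_of_le_one_right (by positivity) (fullMajorant_le_one hW (fun z hz => ?_) hr0 hr)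
  simpa using pow_le_one₀ (norm_nonneg _) (norm_dslope_zero_le_one hw h0 hm hz)

/-- The majorant of a subordinate function is dominated on `|z| ≤ 1 / 3`. -/
theorem fullMajorant_comp_le {F w : ℂ → ℂ} (hF : DifferentiableOn ℂ F unitDisk)
    (hw : DifferentiableOn ℂ w unitDisk) (h0 : w 0 = 0)
    (hm : ∀ z ∈ unitDisk, w z ∈ unitDisk) {r : ℝ} (hr0 : 0 ≤ r) (hr : r ≤ 1 / 3) :
    fullMajorant (fun z => F (w z)) r ≤ fullMajorant F r := by
  set a := taylorCoeff F
  set α : ℕ → ℕ → ℂ := fun n => taylorCoeff (fun z => w z ^ n)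
  have hFw : DifferentiableOn ℂ (fun z => F (w z)) unitDisk := hF.comp hw hm
  have hle : ∀ s : ℝ, 0 ≤ s → s ≤ 1 / 3 → ∀ n,
      ∑' k, ‖a n‖ * (‖α n k‖ * s ^ k) ≤ ‖a n‖ * s ^ n := by
    intro s hs0 hs n
    rw [tsum_mul_left]
    exact mul_le_mul_of_nonneg_left (fullMajorant_schwarz_pow_le hw h0 hm hs0 hs n) (norm_nonneg _)
  -- Absolute convergence of the double series `∑ a n * α n k * z ^ k`, which allows regrouping
  -- `F(w(z))` by powers of `z`.
  have hsum : ∀ s : ℝ, 0 ≤ s → s ≤ 1 / 3 →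
      Summable (fun p : ℕ × ℕ => ‖a p.1‖ * (‖α p.1 p.2‖ * s ^ p.2)) := by
    intro s hs0 hs
    refine (summable_prod_of_nonneg fun p =>
      mul_nonneg (norm_nonneg _) (mul_nonneg (norm_nonneg _) (pow_nonneg hs0 _))).2 ?_
    have hα' : ∀ n, Summable fun k => ‖α n k‖ * s ^ k := fun n =>
      summable_norm_taylorCoeff (differentiableOn_fun_pow hw n) hs0 (by linarith)
    refine ⟨fun n => (hα' n).mul_left ‖a n‖, ?_⟩
    exact Summable.of_nonneg_of_le (fun n => tsum_nonneg fun k => by positivity) (hle s hs0 hs)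
      (summable_norm_taylorCoeff hF hs0 (by linarith))
  have hsumC : ∀ z : ℂ, ‖z‖ ≤ 1 / 3 →
      Summable (fun p : ℕ × ℕ => a p.1 * (α p.1 p.2 * z ^ p.2)) := fun z hz =>
    Summable.of_norm ((hsum ‖z‖ (norm_nonneg z) hz).congr fun p => by rw [norm_mul, norm_mul, norm_pow])
  have hcoef : ∀ k, taylorCoeff (fun z => F (w z)) k = ∑' n, a n * α n k := by
    refine taylorCoeff_eq_of_hasSum (c := fun k => ∑' n, a n * α n k) hFw (ρ := 1 / 3)
      (by norm_num) fun z hz => ?_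
    have hzd : z ∈ unitDisk := by simp; linarith
    have hS := hsumC z hz.le
    have hα' : ∀ n, HasSum (fun k => α n k * z ^ k) (w z ^ n) := fun n =>
      hasSum_taylorCoeff (differentiableOn_fun_pow hw n) hzd
    have h1 : HasSum (fun n => a n * w z ^ n) (∑' p : ℕ × ℕ, a p.1 * (α p.1 p.2 * z ^ p.2)) :=
      hS.hasSum.prod_fiberwise fun n => (hα' n).mul_left (a n)
    have h2 := h1.unique (hasSum_taylorCoeff hF (hm z hzd))
    have hS' := hS.prod_symm
    have h3 := hS'.hasSum.prod_fiberwise fun k => (hS'.prod_factor k).hasSum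
    rw [← h2, ← (Equiv.prodComm ℕ ℕ).tsum_eq]
    refine (hasSum_iff_of_forall_eq ?_).mpr (h3)
    intro k
    simp only [Prod.swap]
    rw [← tsum_mul_right]
    simp only [mul_assoc]
  have hS := (hsum r hr0 hr).prod_symm
  calc fullMajorant (fun z => F (w z)) r
      ≤ ∑' k, ∑' n, ‖a n‖ * (‖α n k‖ * r ^ k) := by
        refine (summable_norm_taylorCoeff hFw hr0 (by linarith)).tsum_le_tsum (fun k => ?_) hS.prod
        rw [hcoef]
        have : ‖∑' n, a n * α n k‖ * r ^ k = ‖∑' n, a n * (α n k * (r : ℂ) ^ k)‖ := by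
          simp only [← mul_assoc]
          rw [tsum_mul_right, norm_mul, norm_pow, norm_real, Real.norm_of_nonneg hr0]
        rw [this]
        have hh := hS.prod_factor k
        refine (norm_tsum_le_tsum_norm ?_).trans_eq ?_
        · simpa [abs_of_nonneg hr0] using hh
        · simp [abs_of_nonneg hr0]
    _ = ∑' n, ∑' k, ‖a n‖ * (‖α n k‖ * r ^ k) := (hsum r hr0 hr).tsum_comm
    _ ≤ fullMajorant F r := (hsum r hr0 hr).prod.tsum_le_tsum (hle r hr0 hr)
        (summable_norm_taylorCoeff hF hr0 (by linarith))

/-! ### Jack's lemma. -/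

theorem nonpos_of_hasDerivAt_of_forall_le {φ : ℝ → ℝ} {d : ℝ} (h : HasDerivAt φ d 0)
    (hle : ∀ s, 0 < s → φ s ≤ φ 0) : d ≤ 0 := by
  have ht := h.tendsto_slope_zero_right
  refine le_of_tendsto ht ?_
  filter_upwards [self_mem_nhdsWithin] with s hs
  have hs' : 0 < s := hs
  have := hle s hs'
  simp only [zero_add, smul_eq_mul]
  exact mul_nonpos_of_nonneg_of_nonpos (by positivity) (by linarith)

/-- **Jack's lemma**, in the form of an obstruction to being a self-map of the disk. -/
theorem exists_jack {v : ℂ → ℂ} (hv : DifferentiableOn ℂ v unitDisk) (h0 : v 0 = 0)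
    (hex : ∃ z ∈ unitDisk, 1 ≤ ‖v z‖) :
    ∃ z₀ ∈ unitDisk, ‖v z₀‖ = 1 ∧ ∃ m : ℝ, 1 ≤ m ∧ z₀ * deriv v z₀ = m * v z₀ := by
  obtain ⟨z₁, hz₁, hv₁⟩ := hex
  have hz₁' : ‖z₁‖ < 1 := by simpa using hz₁
  have hsub₁ : closedBall (0 : ℂ) ‖z₁‖ ⊆ unitDisk := closedBall_subset_ball hz₁'
  have hK : IsCompact (closedBall (0 : ℂ) ‖z₁‖ ∩ (fun z => ‖v z‖) ⁻¹' Set.Ici 1) :=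
    (isCompact_closedBall (0 : ℂ) ‖z₁‖).of_isClosed_subset
      (((hv.mono hsub₁).continuousOn.norm).preimage_isClosed_of_isClosed isClosed_closedBall
        isClosed_Ici) Set.inter_subset_left
  -- `z₀` is a point of least modulus with `|v| ≥ 1`, so `v` maps the disk of radius `|z₀|` into the
  -- unit disk.
  obtain ⟨z₀, ⟨hz₀, hv₀⟩, hmin⟩ := hK.exists_isMinOn ⟨z₁, by simp, hv₁⟩ continuous_norm.continuousOn
  have hv₀ : 1 ≤ ‖v z₀‖ := hv₀
  have hz₀D : z₀ ∈ unitDisk := hsub₁ hz₀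
  have hlt : ∀ z, ‖z‖ < ‖z₀‖ → ‖v z‖ < 1 := by
    intro z hz
    by_contra! h
    have hz₀' : ‖z₀‖ ≤ ‖z₁‖ := by simpa using hz₀
    have : ‖z₀‖ ≤ ‖z‖ := hmin ⟨by simpa using (hz.le.trans hz₀'), h⟩
    linarith
  have hne : z₀ ≠ 0 := by
    rintro rfl
    rw [h0, norm_zero] at hv₀
    linarith
  have hρ : 0 < ‖z₀‖ := norm_pos_iff.2 hne
  have hsub : closedBall (0 : ℂ) ‖z₀‖ ⊆ unitDisk := closedBall_subset_ball (by simpa using hz₀D)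
  have hle : ∀ z, ‖z‖ ≤ ‖z₀‖ → ‖v z‖ ≤ 1 := by
    intro z hz
    have hc : ContinuousOn v (closure (ball 0 ‖z₀‖)) := by
      rw [closure_ball _ hρ.ne']
      exact (hv.mono hsub).continuousOn
    have hmem : z ∈ closure (ball (0 : ℂ) ‖z₀‖) := by
      rw [closure_ball _ hρ.ne']; simpa using hz
    have := hc.image_closure ⟨z, hmem, rfl⟩
    have h2 : closure (v '' ball 0 ‖z₀‖) ⊆ closedBall 0 1 := by
      refine closure_minimal ?_ isClosed_closedBall
      rintro _ ⟨y, hy, rfl⟩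
      simpa using (hlt y (by simpa using hy)).le
    simpa using h2 this
  have heq : ‖v z₀‖ = 1 := le_antisymm (hle z₀ le_rfl) hv₀
  have hschwarz : ∀ z, ‖z‖ ≤ ‖z₀‖ → ‖v z‖ ≤ ‖z‖ / ‖z₀‖ := by
    intro z hz
    rcases hz.lt_or_eq with hz' | hz'
    · have := dist_le_div_mul_dist_of_mapsTo_ball (c := 0) (R₁ := ‖z₀‖) (R₂ := 1) (f := v) (z := z)
        (hv.mono (ball_subset_closedBall.trans hsub)) (fun y hy => by
          rw [h0]; simpa using (hlt y (by simpa using hy)).le) (by simpa using hz')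
      rw [h0, dist_zero_right, dist_zero_right] at this
      calc ‖v z‖ ≤ 1 / ‖z₀‖ * ‖z‖ := this
        _ = ‖z‖ / ‖z₀‖ := by ring
    · rw [hz', div_self hρ.ne']; exact hle z hz
  have hd : HasDerivAt v (deriv v z₀) z₀ :=
    (hv.differentiableAt (isOpen_ball.mem_nhds hz₀D)).hasDerivAt
  set c := z₀ * deriv v z₀ * (starRingEnd ℂ) (v z₀) with hc
  have hvv : v z₀ * (starRingEnd ℂ) (v z₀) = 1 := by
    rw [mul_conj, normSq_eq_norm_sq, heq]; simp
  -- Here `c` is `z₀ v'(z₀) / v(z₀)`, since `|v(z₀)| = 1`. Along `z₀ exp(sζ)` the Schwarz bound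
  -- reads `Re (v * conj (v z₀)) ≤ exp(s Re ζ)`, with equality at `s = 0`; differentiate there.
  have key : ∀ ζ : ℂ, ζ.re ≤ 0 → (c * ζ).re ≤ ζ.re := by
    intro ζ hζ
    have hγ : HasDerivAt (fun s : ℂ => z₀ * exp (s * ζ)) (z₀ * ζ) 0 := by
      have := (((hasDerivAt_id (0 : ℂ)).mul_const ζ).cexp).const_mul z₀
      simpa using this
    have h1 : HasDerivAt (fun s : ℂ => v (z₀ * exp (s * ζ)) * (starRingEnd ℂ) (v z₀) - exp (s * ζ.re))
        (deriv v z₀ * (z₀ * ζ) * (starRingEnd ℂ) (v z₀) - ζ.re) 0 := by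
      have hd' : HasDerivAt v (deriv v z₀) (z₀ * exp (0 * ζ)) := by simpa using hd
      have e1 := (hd'.comp (0 : ℂ) hγ).mul_const ((starRingEnd ℂ) (v z₀))
      have e2 := ((hasDerivAt_id (0 : ℂ)).mul_const (ζ.re : ℂ)).cexp
      simpa using e1.fun_sub e2
    have h2 := HasDerivAt.real_of_complex (z := 0) (by simpa using h1)
    have h3 := nonpos_of_hasDerivAt_of_forall_le h2 (fun s hs => by
      have e0 : (v (z₀ * exp (((0 : ℝ) : ℂ) * ζ)) * (starRingEnd ℂ) (v z₀) -
          exp (((0 : ℝ) : ℂ) * ζ.re)).re = 0 := by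
        simp [hvv]
      rw [e0, sub_re, sub_nonpos]
      have hn : ‖exp ((s : ℂ) * ζ)‖ = Real.exp (s * ζ.re) := by
        rw [norm_exp]; simp
      have hn1 : Real.exp (s * ζ.re) ≤ 1 :=
        Real.exp_le_one_iff.2 (mul_nonpos_of_nonneg_of_nonpos hs.le hζ)
      have hn2 : ‖z₀ * exp ((s : ℂ) * ζ)‖ = ‖z₀‖ * Real.exp (s * ζ.re) := by rw [norm_mul, hn]
      have := hschwarz (z₀ * exp ((s : ℂ) * ζ)) (by
        rw [hn2]; exact mul_le_of_le_one_right hρ.le hn1)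
      rw [hn2, mul_div_cancel_left₀ _ hρ.ne'] at this
      refine (re_le_norm _).trans ?_
      rw [norm_mul, norm_conj, heq, mul_one, ← ofReal_mul, exp_ofReal_re]
      exact this)
    have e3 : deriv v z₀ * (z₀ * ζ) * (starRingEnd ℂ) (v z₀) = c * ζ := by rw [hc]; ring
    rw [e3, sub_re, ofReal_re] at h3
    linarith
  -- `ζ = ±I` force `Im c = 0`, and `ζ = -1` gives `Re c ≥ 1`.
  have k1 := key I (by simp)
  have k2 := key (-I) (by simp)
  have k3 := key (-1) (by simp)
  simp at k1 k2 k3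
  refine ⟨z₀, hz₀D, heq, c.re, k3, ?_⟩
  have : (c.re : ℂ) = c := Complex.ext (by simp) (by simp; linarith)
  rw [this, hc, mul_assoc, mul_comm ((starRingEnd ℂ) _), hvv, mul_one]

/-! ### Factorization of the class through `f₀`. -/

theorem one_add_mul_ne_zero {E : ℝ} (hE : |E| ≤ 1) {z : ℂ} (hz : z ∈ unitDisk) :
    1 + (E : ℂ) * z ≠ 0 := by
  intro h
  have h1 : (E : ℂ) * z = -1 := by linear_combination h
  have h2 : ‖(E : ℂ) * z‖ = 1 := by rw [h1]; simp
  rw [norm_mul, norm_real, Real.norm_eq_abs] at h2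
  have hz' : ‖z‖ < 1 := by simpa using hz
  nlinarith [norm_nonneg z, abs_nonneg E]

/-- A solution of `z v' / (1 + E v) = w / (1 + E w)` with `w` a self-map of the disk is one too. -/
theorem mem_unitDisk_of_deriv_eq {E : ℝ} (hE : |E| ≤ 1) {v w : ℂ → ℂ}
    (hv : DifferentiableOn ℂ v unitDisk) (hv0 : v 0 = 0)
    (hm : ∀ z ∈ unitDisk, w z ∈ unitDisk)
    (hd : ∀ z ∈ unitDisk, z * deriv v z * (1 + E * w z) = (1 + E * v z) * w z) :
    ∀ z ∈ unitDisk, v z ∈ unitDisk := by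
  by_contra! hcon
  obtain ⟨z₁, hz₁, hv₁⟩ := hcon
  obtain ⟨z₀, hz₀, hn, m, hm1, he⟩ := exists_jack hv hv0 ⟨z₁, hz₁, by simpa using hv₁⟩
  have hw : ‖w z₀‖ < 1 := by simpa using hm z₀ hz₀
  -- Taking moduli at the Jack point gives `m ≤ |w| (1 + (m - 1)|E|) ≤ |w| m < m`.
  have h1 : (m : ℂ) * v z₀ = w z₀ * (1 - (m - 1 : ℝ) * E * v z₀) := by
    have := hd z₀ hz₀
    rw [he] at this
    push_cast
    linear_combination this
  have h2 := congrArg norm h1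
  rw [norm_mul, norm_mul, hn, norm_real, Real.norm_of_nonneg (by linarith), mul_one] at h2
  have h3 : ‖1 - ((m - 1 : ℝ) : ℂ) * E * v z₀‖ ≤ m := by
    refine (norm_sub_le _ _).trans ?_
    rw [norm_one, norm_mul, norm_mul, hn, norm_real, norm_real, Real.norm_of_nonneg (by linarith),
      Real.norm_eq_abs]
    nlinarith
  nlinarith [norm_nonneg (w z₀), norm_nonneg (1 - ((m - 1 : ℝ) : ℂ) * E * v z₀)]

theorem re_one_add_mul_pos {E : ℝ} (hE : |E| ≤ 1) {z : ℂ} (hz : z ∈ unitDisk) :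
    0 < (1 + (E : ℂ) * z).re := by
  have hz' : ‖z‖ < 1 := by simpa using hz
  have h1 : |z.re| < 1 := (abs_re_le_norm z).trans_lt hz'
  have h2 : |E * z.re| < 1 := by
    rw [abs_mul]
    nlinarith [abs_nonneg E, abs_nonneg z.re]
  have := (abs_lt.1 h2).1
  simp
  linarith

open Classical in
/-- The logarithm of `f₀(z) / z`. -/
noncomputable def extremalLog (D E : ℝ) (z : ℂ) : ℂ :=
  if E = 0 then D * z else (((D - E) / E : ℝ) : ℂ) * log (1 + E * z)

theorem extremalLog_zero (D E : ℝ) : extremalLog D E 0 = 0 := by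
  simp [extremalLog]

theorem hasDerivAt_extremalLog {D E : ℝ} (hE : |E| ≤ 1) {z : ℂ} (hz : z ∈ unitDisk) :
    HasDerivAt (extremalLog D E) (((D : ℂ) - E) / (1 + E * z)) z := by
  unfold extremalLog
  by_cases h : E = 0
  · subst h
    simpa using (hasDerivAt_id z).const_mul (D : ℂ)
  · simp only [h, if_false]
    have h1 : HasDerivAt (fun z : ℂ => 1 + (E : ℂ) * z) E z := by
      simpa using ((hasDerivAt_id z).const_mul (E : ℂ)).const_add 1
    have h2 := (h1.clog (Or.inl (re_one_add_mul_pos hE hz))).const_mul (((D - E) / E : ℝ) : ℂ)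
    have hEC : (E : ℂ) ≠ 0 := by exact_mod_cast h
    have h3 := one_add_mul_ne_zero hE hz
    refine h2.congr_deriv ?_
    push_cast
    field_simp

theorem janowskiExtremal_eq {D E : ℝ} (hE : |E| ≤ 1) {z : ℂ} (hz : z ∈ unitDisk) :
    janowskiExtremal D E z = z * exp (extremalLog D E z) := by
  unfold janowskiExtremal extremalLog
  split_ifs with h
  · rfl
  · rw [cpow_def_of_ne_zero (one_add_mul_ne_zero hE hz), mul_comm (log _)]

theorem eq_zero_of_id_mul_eq_zero {q : ℂ → ℂ} (hq : ContinuousOn q unitDisk)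
    (h : ∀ z ∈ unitDisk, z * q z = 0) : ∀ z ∈ unitDisk, q z = 0 := by
  have hne : ∀ z ∈ unitDisk, z ≠ 0 → q z = 0 := fun z hz h0 =>
    (mul_eq_zero.1 (h z hz)).resolve_left h0
  intro z hz
  by_cases h0 : z = 0
  · subst h0
    have ht := ((hq.continuousAt (isOpen_ball.mem_nhds hz)).tendsto).mono_left
      (nhdsWithin_le_nhds (s := {(0 : ℂ)}ᶜ))
    refine tendsto_nhds_unique (ht.congr' ?_) tendsto_const_nhds
    filter_upwards [self_mem_nhdsWithin, nhdsWithin_le_nhds (isOpen_ball.mem_nhds hz)] with y hy hy'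
      using hne y hy' hy
  · exact hne z hz h0

/-- The equation separates: if `Λ` is a primitive of `(w/z)/(1 + E w)`, then `log(1 + E v) = E Λ`,
with `v = Λ` as the case `E = 0`. The use of `dslope` removes the singularity at the origin. -/
theorem exists_schwarz_ode {E : ℝ} (hE : |E| ≤ 1) {w : ℂ → ℂ}
    (hw : DifferentiableOn ℂ w unitDisk) (hm : ∀ z ∈ unitDisk, w z ∈ unitDisk) :
    ∃ v : ℂ → ℂ, v 0 = 0 ∧ ∀ z ∈ unitDisk,
      HasDerivAt v ((1 + E * v z) * dslope w 0 z / (1 + E * w z)) z := by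
  have hdiff : DifferentiableOn ℂ (fun z => dslope w 0 z / (1 + E * w z)) unitDisk :=
    (differentiableOn_dslope_zero hw).div ((hw.const_mul _).const_add 1)
      fun z hz => one_add_mul_ne_zero hE (hm z hz)
  obtain ⟨Λ, hΛ0, hΛ⟩ := hdiff.isExactOn_ball.with_val_at 0 0
  by_cases h : E = 0
  · subst h
    exact ⟨Λ, hΛ0, fun z hz => by simpa using hΛ z hz⟩
  · have hEC : (E : ℂ) ≠ 0 := by exact_mod_cast h
    refine ⟨fun z => (exp (E * Λ z) - 1) / E, by simp [hΛ0], fun z hz => ?_⟩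
    have := ((((hΛ z hz).const_mul (E : ℂ)).cexp).sub_const 1).div_const (E : ℂ)
    refine this.congr_deriv ?_
    field_simp
    ring

/-- Members of the Janowski class have the form `z H(v(z))` with `f₀(z) = z H(z)`. -/
theorem exists_eq_mul_exp_extremalLog {D E : ℝ} (hE : |E| ≤ 1) {f : ℂ → ℂ}
    (hf : f ∈ starlikeClass (janowskiPsi D E)) :
    ∃ v : ℂ → ℂ, DifferentiableOn ℂ v unitDisk ∧ v 0 = 0 ∧ (∀ z ∈ unitDisk, v z ∈ unitDisk) ∧
      ∀ z ∈ unitDisk, f z = z * exp (extremalLog D E (v z)) := by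
  obtain ⟨⟨hfd, hf0, hf1⟩, hfne, w, hw, hw0, hwm, hwf⟩ := hf
  have h0D : (0 : ℂ) ∈ unitDisk := by simp
  obtain ⟨v, hv0, hv⟩ := exists_schwarz_ode hE hw hwm
  have hvd : DifferentiableOn ℂ v unitDisk := fun z hz =>
    (hv z hz).differentiableAt.differentiableWithinAt
  have hvm := mem_unitDisk_of_deriv_eq hE hvd hv0 hwm (fun z hz => by
    have h1 := one_add_mul_ne_zero hE (hwm z hz)
    rw [(hv z hz).deriv, mul_assoc, div_mul_cancel₀ _ h1]
    linear_combination (1 + E * v z) * mul_dslope_zero hw0 z)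
  refine ⟨v, hvd, hv0, hvm, ?_⟩
  set h := dslope f 0 with hh
  have hhd : DifferentiableOn ℂ h unitDisk := differentiableOn_dslope_zero hfd
  have hfz : ∀ z, z * h z = f z := mul_dslope_zero hf0
  have hh0 : h 0 = 1 := by rw [hh, dslope_same, hf1]
  have hhder : ∀ z ∈ unitDisk, HasDerivAt h (deriv h z) z := fun z hz =>
    (hhd.differentiableAt (isOpen_ball.mem_nhds hz)).hasDerivAt
  -- The subordination rewritten for `h = f/z`, namely `z h'/h = ψ(w) - 1`.
  have hode : ∀ z ∈ unitDisk, z * deriv h z * (1 + E * w z) = h z * (D - E) * w z := by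
    intro z hz
    by_cases hz0 : z = 0
    · subst hz0; simp [hw0]
    have h1 := one_add_mul_ne_zero hE (hwm z hz)
    have h2 : deriv f z = h z + z * deriv h z := by
      have e : f = fun z => z * h z := funext fun z => (hfz z).symm
      have := ((hasDerivAt_id z).mul (hhder z hz)).deriv
      rw [one_mul] at this
      rw [e]
      exact this
    have h3 := hwf z hz
    have h4 : f z ≠ 0 := hfne z hz hz0
    have h5 : h z ≠ 0 := by
      rintro h5; rw [← hfz, h5, mul_zero] at h4; exact h4 rfl
    simp only [logDerivQuotient, hz0, if_false, janowskiPsi] at h3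
    rw [div_eq_div_iff h4 h1, h2, ← hfz] at h3
    have h6 : z * ((h z + z * deriv h z) * (1 + E * w z)) = z * ((1 + D * w z) * h z) := by
      linear_combination h3
    have h7 := mul_left_cancel₀ hz0 h6
    linear_combination h7
  -- By the equation for `v`, `h` and `H ∘ v` have the same logarithmic derivative, so this quotient
  -- is constant, equal to its value `1` at the origin.
  set g : ℂ → ℂ := fun z => h z * exp (-extremalLog D E (v z)) with hg
  have hgd : ∀ z ∈ unitDisk, HasDerivAt g
      ((deriv h z - h z * ((D - E) * dslope w 0 z / (1 + E * w z))) *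
        exp (-extremalLog D E (v z))) z := by
    intro z hz
    have e1 := (((hasDerivAt_extremalLog (D := D) hE (hvm z hz)).comp z (hv z hz)).neg).cexp
    have e2 := (hhder z hz).mul e1
    have h1 := one_add_mul_ne_zero hE (hwm z hz)
    have h2 := one_add_mul_ne_zero hE (hvm z hz)
    refine e2.congr_deriv ?_
    simp only [Pi.neg_apply, Function.comp]
    field_simp
    ring
  have hgdiff : DifferentiableOn ℂ g unitDisk := fun z hz =>
    (hgd z hz).differentiableAt.differentiableWithinAt
  have hg' : ∀ z ∈ unitDisk, deriv g z = 0 := by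
    refine eq_zero_of_id_mul_eq_zero (hgdiff.deriv isOpen_ball).continuousOn fun z hz => ?_
    have h1 := one_add_mul_ne_zero hE (hwm z hz)
    have h2 := hode z hz
    have h3 : z * (deriv h z - h z * ((D - E) * dslope w 0 z / (1 + E * w z))) = 0 := by
      have h4 := mul_dslope_zero hw0 z
      field_simp
      linear_combination h2 - h z * (D - E) * h4
    rw [(hgd z hz).deriv, ← mul_assoc, h3, zero_mul]
  intro z hz
  have hc := isOpen_ball.is_const_of_deriv_eq_zero (convex_ball (0 : ℂ) 1).isPreconnected hgdiff
    (fun y hy => hg' y hy) hz h0D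
  simp only [hg, hv0, extremalLog_zero, hh0, neg_zero, exp_zero, mul_one] at hc
  rw [exp_neg, mul_inv_eq_iff_eq_mul₀ (exp_ne_zero _), one_mul] at hc
  rw [← hfz, hc]

/-! ### Univalence and the boundary of the image. -/

theorem hasStrictDerivAt_of_mem_unitDisk {f : ℂ → ℂ} (hf : DifferentiableOn ℂ f unitDisk) {a : ℂ}
    (ha : a ∈ unitDisk) : HasStrictDerivAt f (deriv f a) a :=
  (hf.analyticAt (isOpen_ball.mem_nhds ha)).hasStrictDerivAt

theorem exists_local_inverse {f : ℂ → ℂ} (hf : DifferentiableOn ℂ f unitDisk) {a : ℂ}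
    (ha : a ∈ unitDisk) (hd : deriv f a ≠ 0) :
    ∃ g : ℂ → ℂ, g (f a) = a ∧ HasDerivAt g (deriv f a)⁻¹ (f a) ∧
      (∀ᶠ x in 𝓝 (f a), f (g x) = x) ∧ ∀ᶠ x in 𝓝 a, g (f x) = x := by
  have hs := hasStrictDerivAt_of_mem_unitDisk hf ha
  refine ⟨hs.localInverse f _ a hd, ?_, (hs.to_localInverse hd).hasDerivAt,
    hs.eventually_right_inverse hd, hs.eventually_left_inverse hd⟩
  exact (hs.eventually_left_inverse hd).self_of_nhds

/-- Lifting `t f(a)` through the local inverse, `|γ|²` has derivative `2|a|² Re (f(a)/(a f'(a))) >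
0` at `t = 1`: shrinking the value radially moves the preimage strictly inward. -/
theorem exists_radial_lift {f : ℂ → ℂ} (hf : DifferentiableOn ℂ f unitDisk) {a : ℂ}
    (ha : a ∈ unitDisk) (ha0 : a ≠ 0) (hd : deriv f a ≠ 0) (hfa : f a ≠ 0)
    (hre : 0 < (a * deriv f a / f a).re) :
    ∃ γ : ℝ → ℂ, Tendsto γ (𝓝[<] 1) (𝓝 a) ∧
      ∀ᶠ t in 𝓝[<] 1, f (γ t) = t * f a ∧ ‖γ t‖ < ‖a‖ := by
  obtain ⟨g, hga, hg, hfg, -⟩ := exists_local_inverse hf ha hd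
  have hl : HasDerivAt (fun t : ℝ => (t : ℂ) * f a) (f a) 1 := by
    simpa using (ofRealCLM.hasDerivAt (x := (1 : ℝ))).mul_const (f a)
  have hg' : HasDerivAt g (deriv f a)⁻¹ (((1 : ℝ) : ℂ) * f a) := by simpa using hg
  have hγ : HasDerivAt (fun t : ℝ => g (t * f a)) ((deriv f a)⁻¹ * f a) 1 := hg'.comp 1 hl
  have h1 : g (((1 : ℝ) : ℂ) * f a) = a := by simpa using hga
  refine ⟨fun t => g (t * f a), ?_, ?_⟩
  · have := hγ.continuousAt.tendsto
    rw [h1] at this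
    exact this.mono_left nhdsWithin_le_nhds
  · have hl' : Tendsto (fun t : ℝ => (t : ℂ) * f a) (𝓝[<] 1) (𝓝 (f a)) := by
      have := hl.continuousAt.tendsto
      simp only [ofReal_one, one_mul] at this
      exact this.mono_left nhdsWithin_le_nhds
    refine (hl'.eventually hfg).and ?_
    have hn := hγ.norm_sq
    rw [h1, Complex.inner, mul_comm _ ((starRingEnd ℂ) a)] at hn
    have hpos : 0 < 2 * ((starRingEnd ℂ) a * ((deriv f a)⁻¹ * f a)).re := by
      have e : (starRingEnd ℂ) a * ((deriv f a)⁻¹ * f a) =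
          ((‖a‖ ^ 2 : ℝ) : ℂ) * (a * deriv f a / f a)⁻¹ := by
        rw [← normSq_eq_norm_sq, ← mul_conj]
        field_simp
      rw [e, re_ofReal_mul, inv_re]
      have hz : a * deriv f a / f a ≠ 0 := div_ne_zero (mul_ne_zero ha0 hd) hfa
      have := normSq_pos.2 hz
      have := norm_pos_iff.2 ha0
      positivity
    have ht := (hasDerivAt_iff_tendsto_slope.1 hn).mono_left
      (nhdsWithin_mono (1 : ℝ) (fun x (hx : x < 1) => hx.ne))
    filter_upwards [ht.eventually (lt_mem_nhds hpos), self_mem_nhdsWithin] with t h3 h4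
    have h4 : t < 1 := h4
    rw [slope_def_field, h1] at h3
    have h5 : ‖g (t * f a)‖ ^ 2 - ‖a‖ ^ 2 < 0 := by
      by_contra! h
      exact absurd h3 (not_lt.2 (div_nonpos_of_nonneg_of_nonpos h (by linarith)))
    exact lt_of_pow_lt_pow_left₀ 2 (norm_nonneg _) (by linarith)

/-- Starlike functions are univalent. -/
theorem injOn_of_starlike {f : ℂ → ℂ} (hf : DifferentiableOn ℂ f unitDisk) (hf0 : f 0 = 0)
    (hd : ∀ z ∈ unitDisk, deriv f z ≠ 0) (hne : ∀ z ∈ unitDisk, z ≠ 0 → f z ≠ 0)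
    (hre : ∀ z ∈ unitDisk, z ≠ 0 → 0 < (z * deriv f z / f z).re) : Set.InjOn f unitDisk := by
  intro z₁ hz₁ z₂ hz₂ he
  by_contra hz
  set r := max ‖z₁‖ ‖z₂‖ with hr
  have hr1 : r < 1 := max_lt (by simpa using hz₁) (by simpa using hz₂)
  have hsub : closedBall (0 : ℂ) r ⊆ unitDisk := closedBall_subset_ball hr1
  set K : Set (ℂ × ℂ) := closedBall 0 r ×ˢ closedBall 0 r
  have hK : IsCompact K := (isCompact_closedBall _ _).prod (isCompact_closedBall _ _)
  have hT : IsCompact (K ∩ (fun p : ℂ × ℂ => f p.1 - f p.2) ⁻¹' {0}) := by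
    have hc : ContinuousOn (fun p : ℂ × ℂ => f p.1 - f p.2) K :=
      (hf.continuousOn.comp continuousOn_fst fun p hp => hsub hp.1).sub
        (hf.continuousOn.comp continuousOn_snd fun p hp => hsub hp.2)
    exact hK.of_isClosed_subset
      (hc.preimage_isClosed_of_isClosed hK.isClosed isClosed_singleton) Set.inter_subset_left
  have hloc : ∀ a ∈ unitDisk, ∃ U : Set ℂ, IsOpen U ∧ a ∈ U ∧ Set.InjOn f U := by
    intro a ha
    obtain ⟨g, -, -, -, hg⟩ := exists_local_inverse hf ha (hd a ha)
    obtain ⟨U, hU, hUo, haU⟩ := _root_.eventually_nhds_iff.1 hg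
    exact ⟨U, hUo, haU, fun x hx y hy hxy => by rw [← hU x hx, ← hU y hy, hxy]⟩
  choose! U hUo hUm hUi using hloc
  -- Removing this open neighbourhood of the diagonal keeps the set of pairs with equal values
  -- compact but loses no pair of distinct points. A pair minimizing the larger modulus then exists,
  -- and radial lifts of both points give a smaller one.
  set V : Set (ℂ × ℂ) := ⋃ a ∈ unitDisk, U a ×ˢ U a
  have hV : IsOpen V := isOpen_biUnion fun a ha => (hUo a ha).prod (hUo a ha)
  have hmem : ∀ a b : ℂ, ‖a‖ ≤ r → ‖b‖ ≤ r → f a = f b → a ≠ b →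
      (a, b) ∈ (K ∩ (fun p : ℂ × ℂ => f p.1 - f p.2) ⁻¹' {0}) \ V := by
    intro a b ha hb hab hne
    refine ⟨⟨⟨by simpa using ha, by simpa using hb⟩, by simpa using sub_eq_zero.2 hab⟩, ?_⟩
    simp only [V, Set.mem_iUnion, not_exists]
    rintro c hc ⟨h1, h2⟩
    exact hne (hUi c hc h1 h2 hab)
  obtain ⟨⟨a, b⟩, ⟨⟨⟨haK, hbK⟩, hab⟩, hnV⟩, hmin⟩ := (hT.diff hV).exists_isMinOn
    ⟨(z₁, z₂), hmem z₁ z₂ (le_max_left _ _) (le_max_right _ _) he hz⟩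
    (f := fun p : ℂ × ℂ => max ‖p.1‖ ‖p.2‖) (by fun_prop)
  simp only at haK hbK
  have haD := hsub haK
  have hbD := hsub hbK
  have hab : f a = f b := by simpa [sub_eq_zero] using hab
  have hne' : a ≠ b := by
    rintro rfl
    exact hnV (Set.mem_biUnion haD ⟨hUm a haD, hUm a haD⟩)
  have ha0 : a ≠ 0 := by
    rintro rfl
    exact hne b hbD hne'.symm (by rw [← hab, hf0])
  have hb0 : b ≠ 0 := by
    rintro rfl
    exact hne a haD ha0 (by rw [hab, hf0])
  obtain ⟨α, hα, hα'⟩ := exists_radial_lift hf haD ha0 (hd a haD) (hne a haD ha0) (hre a haD ha0)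
  obtain ⟨β, hβ, hβ'⟩ := exists_radial_lift hf hbD hb0 (hd b hbD) (hne b hbD hb0) (hre b hbD hb0)
  have hev : ∀ᶠ t in 𝓝[<] (1 : ℝ), α t ≠ β t :=
    (hα.prodMk_nhds hβ).eventually ((isOpen_ne_fun continuous_fst continuous_snd).mem_nhds hne')
  obtain ⟨t, ⟨h1, h2⟩, ⟨h3, h4⟩, h5⟩ := (hα'.and (hβ'.and hev)).exists
  have haK' : ‖a‖ ≤ r := by simpa using haK
  have hbK' : ‖b‖ ≤ r := by simpa using hbK
  have := hmin (hmem (α t) (β t) (h2.le.trans haK') (h4.le.trans hbK') (by rw [h1, h3, hab]) h5)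
  exact absurd this (not_le.2 (max_lt_max h2 h4))

theorem image_mem_nhds_of_deriv_ne_zero {f : ℂ → ℂ} (hf : DifferentiableOn ℂ f unitDisk) {a : ℂ}
    (ha : a ∈ unitDisk) (hd : deriv f a ≠ 0) {U : Set ℂ} (hU : U ∈ 𝓝 a) : f '' U ∈ 𝓝 (f a) := by
  rw [← (hasStrictDerivAt_of_mem_unitDisk hf ha).map_nhds_eq hd]
  exact image_mem_map hU

theorem isOpen_image_unitDisk {f : ℂ → ℂ} (hf : DifferentiableOn ℂ f unitDisk)
    (hd : ∀ z ∈ unitDisk, deriv f z ≠ 0) : IsOpen (f '' unitDisk) := by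
  rw [isOpen_iff_mem_nhds]
  rintro _ ⟨a, ha, rfl⟩
  exact image_mem_nhds_of_deriv_ne_zero hf ha (hd a ha) (isOpen_ball.mem_nhds ha)

/-- The image of the disk under a univalent function is not the whole plane. -/
theorem image_unitDisk_ne_univ {f : ℂ → ℂ} (hf : DifferentiableOn ℂ f unitDisk)
    (hd : ∀ z ∈ unitDisk, deriv f z ≠ 0) (hinj : Set.InjOn f unitDisk) :
    f '' unitDisk ≠ Set.univ := by
  intro hu
  have hsurj : ∀ y, ∃ z ∈ unitDisk, f z = y := fun y => by
    have : y ∈ f '' unitDisk := hu ▸ Set.mem_univ y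
    exact this
  -- The inverse would be a bounded entire function, against Liouville.
  choose G hG hfG using hsurj
  have hGd : Differentiable ℂ G := by
    intro y
    obtain ⟨g, hga, hg, hfg, -⟩ := exists_local_inverse hf (hG y) (hd _ (hG y))
    rw [hfG] at hga hg hfg
    have hgD : ∀ᶠ x in 𝓝 y, g x ∈ unitDisk := by
      refine hg.continuousAt.eventually (isOpen_ball.mem_nhds ?_)
      rw [hga]; exact hG y
    refine (hg.congr_of_eventuallyEq ?_).differentiableAt
    filter_upwards [hfg, hgD] with x h1 h2
    exact hinj (hG x) h2 (by rw [h1, hfG])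
  have hb : Bornology.IsBounded (Set.range G) :=
    isBounded_ball.subset (Set.range_subset_iff.2 hG)
  have hGf : ∀ z ∈ unitDisk, G (f z) = z := fun z hz => hinj (hG _) hz (hfG _)
  have h := hGd.apply_eq_apply_of_bounded hb (f 0) (f (1 / 2))
  rw [hGf 0 (by simp), hGf (1 / 2) (by simp; norm_num)] at h
  norm_num at h

/-- A boundary point of modulus below `δ` is a limit of values taken on a closed disk of radius `ρ <
1`, hence by compactness a value itself; but an open image misses its boundary. -/
theorem le_boundaryDist {f : ℂ → ℂ} (hf : DifferentiableOn ℂ f unitDisk) (hf0 : f 0 = 0)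
    (ho : IsOpen (f '' unitDisk)) (hu : f '' unitDisk ≠ Set.univ) {δ : ℝ} (hδ : 0 < δ)
    (h : ∀ z ∈ unitDisk, ‖z‖ * δ ≤ ‖f z‖) : δ ≤ boundaryDist f := by
  -- `infDist` to the empty set is `0`, so the bound would fail without a boundary.
  have hne : (frontier (f '' unitDisk)).Nonempty := by
    rw [Set.nonempty_iff_ne_empty, Ne, frontier_eq_empty_iff, not_or]
    exact ⟨(Set.Nonempty.image f ⟨0, by simp⟩).ne_empty, hu⟩
  rw [boundaryDist, hf0, le_infDist hne]
  intro y hy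
  rw [dist_zero_left]
  by_contra! hlt
  obtain ⟨ρ, hρ1, hρ2⟩ := exists_between ((div_lt_one hδ).2 hlt)
  rw [div_lt_iff₀ hδ] at hρ1
  rw [ho.frontier_eq] at hy
  have hO : IsOpen {x : ℂ | ‖x‖ < ρ * δ} := isOpen_lt continuous_norm continuous_const
  have h1 : y ∈ closure (f '' unitDisk ∩ {x : ℂ | ‖x‖ < ρ * δ}) :=
    hO.closure_inter ⟨hy.1, hρ1⟩
  have hsub : closedBall (0 : ℂ) ρ ⊆ unitDisk := closedBall_subset_ball hρ2
  have hcl : IsClosed (f '' closedBall 0 ρ) :=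
    ((isCompact_closedBall (0 : ℂ) ρ).image_of_continuousOn (hf.mono hsub).continuousOn).isClosed
  have h2 : y ∈ f '' closedBall 0 ρ := by
    refine closure_minimal ?_ hcl h1
    rintro _ ⟨⟨z, hz, rfl⟩, hzl⟩
    refine ⟨z, ?_, rfl⟩
    have hzl : ‖f z‖ < ρ * δ := hzl
    have := h z hz
    simpa using (lt_of_mul_lt_mul_right (this.trans_lt hzl) hδ.le).le
  exact hy.2 (Set.image_mono hsub h2)

/-- If the limit were `f(a)`, openness and injectivity would confine the points `-r` to a disk of
radius `s < 1`, while `r → 1`. -/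
theorem mem_frontier_of_tendsto {f : ℂ → ℂ} (hf : DifferentiableOn ℂ f unitDisk)
    (hd : ∀ z ∈ unitDisk, deriv f z ≠ 0) (hinj : Set.InjOn f unitDisk) {y : ℂ}
    (hy : Tendsto (fun r : ℝ => f (-r)) (𝓝[<] 1) (𝓝 y)) : y ∈ frontier (f '' unitDisk) := by
  have hD : ∀ᶠ r : ℝ in 𝓝[<] 1, (-r : ℂ) ∈ unitDisk := by
    filter_upwards [Ioo_mem_nhdsLT (show (0 : ℝ) < 1 by norm_num)] with r hr
    simpa [abs_of_pos hr.1] using hr.2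
  rw [(isOpen_image_unitDisk hf hd).frontier_eq]
  refine ⟨mem_closure_of_tendsto hy (hD.mono fun r hr => ⟨_, hr, rfl⟩), ?_⟩
  rintro ⟨a, ha, rfl⟩
  have ha' : ‖a‖ < 1 := by simpa using ha
  obtain ⟨s, hs1, hs2⟩ := exists_between ha'
  have hU := image_mem_nhds_of_deriv_ne_zero hf ha (hd a ha)
    (isOpen_ball.mem_nhds (show a ∈ ball (0 : ℂ) s by simpa using hs1))
  obtain ⟨r, ⟨z, hz, hzr⟩, hr, hrs⟩ :=
    ((hy.eventually hU).and (hD.and (Ioo_mem_nhdsLT hs2))).exists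
  have := hinj (ball_subset_ball hs2.le hz) hr hzr
  rw [this] at hz
  have h0 : 0 < s := (norm_nonneg a).trans_lt hs1
  have : |r| < s := by simpa using hz
  linarith [le_abs_self r, hrs.1]

/-! ### Geometry of the Janowski class and of `f₀`. -/

theorem re_janowskiPsi_pos {D E : ℝ} (hE : |E| ≤ 1) (hD : |D| ≤ 1) {w : ℂ} (hw : w ∈ unitDisk) :
    0 < (janowskiPsi D E w).re := by
  have h1 := re_one_add_mul_pos hE hw
  have h2 := re_one_add_mul_pos hD hw
  have h3 := normSq_pos.2 (one_add_mul_ne_zero hE hw)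
  have hw' : w.re ^ 2 + w.im ^ 2 < 1 := by
    have : ‖w‖ ^ 2 < 1 := by
      have : ‖w‖ < 1 := by simpa using hw
      exact pow_lt_one₀ (norm_nonneg _) this two_ne_zero
    rw [← normSq_eq_norm_sq, normSq_apply] at this
    nlinarith
  rw [janowskiPsi, div_re, ← add_div]
  refine div_pos ?_ h3
  simp only [add_re, one_re, mul_re, ofReal_re, ofReal_im, zero_mul, sub_zero, add_im, one_im,
    mul_im, add_zero, zero_add] at h1 h2 ⊢
  obtain ⟨hE1, hE2⟩ := abs_le.1 hE
  obtain ⟨hD1, hD2⟩ := abs_le.1 hD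
  -- With `w = x + iy` the numerator is `(1 + Dx)(1 + Ex) + DE y²`. If `DE < 0`, it exceeds `1 + (D
  -- + E)x + DE`, which is affine in `x` and equals `(1 ± D)(1 ± E)` at `x = ±1`.
  rcases le_or_gt 0 (D * E) with h | h
  · nlinarith [mul_pos h1 h2, mul_nonneg h (sq_nonneg w.im)]
  · have hx : |w.re| ≤ 1 := abs_le_one_iff_mul_self_le_one.2 (by nlinarith [sq_nonneg w.im])
    obtain ⟨hx1, hx2⟩ := abs_le.1 hx
    have e1 : 0 ≤ (1 - w.re) * ((1 - D) * (1 - E)) :=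
      mul_nonneg (by linarith) (mul_nonneg (by linarith) (by linarith))
    have e2 : 0 ≤ (1 + w.re) * ((1 + D) * (1 + E)) :=
      mul_nonneg (by linarith) (mul_nonneg (by linarith) (by linarith))
    nlinarith [mul_pos_of_neg_of_neg h (sub_neg.2 hw')]

theorem re_pos_of_mem_starlikeClass {D E : ℝ} (hE : |E| ≤ 1) (hD : |D| ≤ 1) {f : ℂ → ℂ}
    (hf : f ∈ starlikeClass (janowskiPsi D E)) {z : ℂ} (hz : z ∈ unitDisk) (h0 : z ≠ 0) :
    0 < (z * deriv f z / f z).re := by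
  obtain ⟨-, -, w, -, -, hwm, hwf⟩ := hf
  have := hwf z hz
  rw [logDerivQuotient, if_neg h0] at this
  rw [this]
  exact re_janowskiPsi_pos hE hD (hwm z hz)

theorem deriv_ne_zero_of_mem_starlikeClass {D E : ℝ} (hE : |E| ≤ 1) (hD : |D| ≤ 1) {f : ℂ → ℂ}
    (hf : f ∈ starlikeClass (janowskiPsi D E)) {z : ℂ} (hz : z ∈ unitDisk) : deriv f z ≠ 0 := by
  intro h
  rcases eq_or_ne z 0 with rfl | h0
  · rw [hf.1.2.2] at h
    exact one_ne_zero h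
  · have := re_pos_of_mem_starlikeClass hE hD hf hz h0
    simp [h] at this

theorem injOn_of_mem_starlikeClass {D E : ℝ} (hE : |E| ≤ 1) (hD : |D| ≤ 1) {f : ℂ → ℂ}
    (hf : f ∈ starlikeClass (janowskiPsi D E)) : Set.InjOn f unitDisk :=
  injOn_of_starlike hf.1.1 hf.1.2.1 (fun _ hz => deriv_ne_zero_of_mem_starlikeClass hE hD hf hz)
    hf.2.1 fun _ hz h0 => re_pos_of_mem_starlikeClass hE hD hf hz h0

open Classical in
/-- The logarithm of `f₀(x) / x` for real `x`. -/
noncomputable def realExtremalLog (D E x : ℝ) : ℝ :=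
  if E = 0 then D * x else (D - E) / E * Real.log (1 + E * x)

/-- The number `-f₀(-1)`. -/
noncomputable def extremalDist (D E : ℝ) : ℝ := Real.exp (realExtremalLog D E (-1))

theorem extremalDist_pos (D E : ℝ) : 0 < extremalDist D E := Real.exp_pos _

theorem extremalLog_ofReal {D E x : ℝ} (h : 0 < 1 + E * x) :
    extremalLog D E x = realExtremalLog D E x := by
  unfold extremalLog realExtremalLog
  split_ifs
  · push_cast; rfl
  · rw [ofReal_mul, ofReal_log h.le]
    push_cast
    rfl

theorem one_add_mul_pos {E x : ℝ} (hE : |E| ≤ 1) (hx : |x| < 1) : 0 < 1 + E * x := by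
  have : |E * x| < 1 := by
    rw [abs_mul]
    nlinarith [abs_nonneg E, abs_nonneg x]
  linarith [(abs_lt.1 this).1]

theorem janowskiExtremal_ofReal {D E x : ℝ} (hE : |E| ≤ 1) (hx : |x| < 1) :
    janowskiExtremal D E x = ((x * Real.exp (realExtremalLog D E x) : ℝ) : ℂ) := by
  rw [janowskiExtremal_eq hE (by simpa using hx), extremalLog_ofReal (one_add_mul_pos hE hx)]
  push_cast
  rfl

/-- `log |H(z)|` is `((D - E)/E) log |1 + E z|`, or `D Re z` if `E = 0`. The exponent has the sign
of `E`, so the upper bound `|1 + E z| ≤ 1 - E` serves for `E < 0` and the lower bound `|1 + E z| ≥ 1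
- E` for `E > 0`. -/
theorem extremalDist_le_norm_exp {D E : ℝ} (hE : -1 ≤ E) (hED : E < D) (hD : D ≤ 1) {z : ℂ}
    (hz : z ∈ unitDisk) : extremalDist D E ≤ ‖exp (extremalLog D E z)‖ := by
  have hz' : ‖z‖ < 1 := by simpa using hz
  have hre := abs_lt.1 ((abs_re_le_norm z).trans_lt hz')
  have hE' : |E| ≤ 1 := abs_le.2 ⟨hE, by linarith⟩
  rw [norm_exp, extremalDist, Real.exp_le_exp]
  unfold extremalLog realExtremalLog
  split_ifs with h
  · subst h
    simp only [re_ofReal_mul]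
    nlinarith
  · rw [re_ofReal_mul, log_re]
    have hpos : 0 < ‖1 + (E : ℂ) * z‖ := norm_pos_iff.2 (one_add_mul_ne_zero hE' hz)
    have h1 : ‖(E : ℂ) * z‖ ≤ |E| := by
      rw [norm_mul, norm_real, Real.norm_eq_abs]
      exact mul_le_of_le_one_right (abs_nonneg _) hz'.le
    rcases lt_or_gt_of_ne h with h' | h'
    · refine mul_le_mul_of_nonpos_left (Real.log_le_log hpos ?_)
        (div_nonpos_of_nonneg_of_nonpos (by linarith) h'.le)
      refine (norm_add_le _ _).trans ?_
      rw [abs_of_neg h'] at h1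
      rw [norm_one]
      linarith
    · refine mul_le_mul_of_nonneg_left (Real.log_le_log (by linarith) ?_)
        (div_nonneg (by linarith) h'.le)
      have := norm_sub_le (1 + (E : ℂ) * z) ((E : ℂ) * z)
      rw [add_sub_cancel_right, norm_one] at this
      rw [abs_of_pos h'] at h1
      linarith

theorem extremalDist_le_boundaryDist {D E : ℝ} (hE : -1 ≤ E) (hED : E < D) (hD : D ≤ 1)
    {f : ℂ → ℂ} (hf : f ∈ starlikeClass (janowskiPsi D E)) :
    extremalDist D E ≤ boundaryDist f := by
  have hE' : |E| ≤ 1 := abs_le.2 ⟨hE, by linarith⟩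
  have hD' : |D| ≤ 1 := abs_le.2 ⟨by linarith, hD⟩
  have hd : ∀ z ∈ unitDisk, deriv f z ≠ 0 := fun _ hz =>
    deriv_ne_zero_of_mem_starlikeClass hE' hD' hf hz
  obtain ⟨v, -, -, hvm, hv⟩ := exists_eq_mul_exp_extremalLog hE' hf
  refine le_boundaryDist hf.1.1 hf.1.2.1 (isOpen_image_unitDisk hf.1.1 hd)
    (image_unitDisk_ne_univ hf.1.1 hd (injOn_of_mem_starlikeClass hE' hD' hf))
    (extremalDist_pos D E) fun z hz => ?_
  rw [hv z hz, norm_mul]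
  exact mul_le_mul_of_nonneg_left (extremalDist_le_norm_exp hE hED hD (hvm z hz)) (norm_nonneg _)

theorem hasDerivAt_janowskiExtremal {D E : ℝ} (hE : |E| ≤ 1) {z : ℂ} (hz : z ∈ unitDisk) :
    HasDerivAt (janowskiExtremal D E)
      (exp (extremalLog D E z) * ((1 + D * z) / (1 + E * z))) z := by
  have h := (hasDerivAt_id z).mul (hasDerivAt_extremalLog (D := D) hE hz).cexp
  have h1 := one_add_mul_ne_zero hE hz
  have h2 : (1 + (D : ℂ) * z) / (1 + E * z) = 1 + z * ((D - E) / (1 + E * z)) := by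
    rw [div_eq_iff h1, add_mul, mul_assoc, div_mul_cancel₀ _ h1]
    ring
  refine (h.congr_deriv ?_).congr_of_eventuallyEq ?_
  · rw [h2]
    simp only [id]
    ring
  · filter_upwards [isOpen_ball.mem_nhds hz] with y hy using janowskiExtremal_eq hE hy

theorem janowskiExtremal_mem_starlikeClass {D E : ℝ} (hE : |E| ≤ 1) :
    janowskiExtremal D E ∈ starlikeClass (janowskiPsi D E) := by
  have h0 : (0 : ℂ) ∈ unitDisk := by simp
  have hne : ∀ z ∈ unitDisk, z ≠ 0 → janowskiExtremal D E z ≠ 0 := fun z hz hz0 => by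
    rw [janowskiExtremal_eq hE hz]
    exact mul_ne_zero hz0 (exp_ne_zero _)
  refine ⟨⟨fun z hz => (hasDerivAt_janowskiExtremal hE hz).differentiableAt.differentiableWithinAt,
    by rw [janowskiExtremal_eq hE h0, zero_mul], ?_⟩, hne, id, differentiableOn_id, rfl,
    fun z hz => hz, fun z hz => ?_⟩
  · rw [(hasDerivAt_janowskiExtremal hE h0).deriv, extremalLog_zero]
    simp
  · unfold logDerivQuotient
    split_ifs with h
    · simp [h, janowskiPsi]
    · rw [(hasDerivAt_janowskiExtremal hE hz).deriv, janowskiExtremal_eq hE hz, janowskiPsi]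
      have h1 := one_add_mul_ne_zero hE hz
      have h2 := exp_ne_zero (extremalLog D E z)
      simp only [id]
      field_simp

theorem hasDerivAt_realExtremalLog {D E x : ℝ} (h : 0 < 1 + E * x) :
    HasDerivAt (realExtremalLog D E) ((D - E) / (1 + E * x)) x := by
  unfold realExtremalLog
  by_cases h0 : E = 0
  · subst h0
    simpa using (hasDerivAt_id x).const_mul D
  · simp only [h0, if_false]
    have h1 : HasDerivAt (fun x : ℝ => 1 + E * x) E x := by
      simpa using ((hasDerivAt_id x).const_mul E).const_add 1
    refine ((h1.log h.ne').const_mul ((D - E) / E)).congr_deriv ?_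
    field_simp

theorem boundaryDist_janowskiExtremal {D E : ℝ} (hE : -1 ≤ E) (hED : E < D) (hD : D ≤ 1) :
    boundaryDist (janowskiExtremal D E) = extremalDist D E := by
  have hE' : |E| ≤ 1 := abs_le.2 ⟨hE, by linarith⟩
  have hD' : |D| ≤ 1 := abs_le.2 ⟨by linarith, hD⟩
  have hf := janowskiExtremal_mem_starlikeClass (D := D) hE'
  refine le_antisymm ?_ (extremalDist_le_boundaryDist hE hED hD hf)
  have hfr : ((-extremalDist D E : ℝ) : ℂ) ∈ frontier (janowskiExtremal D E '' unitDisk) := by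
    refine mem_frontier_of_tendsto hf.1.1
      (fun _ hz => deriv_ne_zero_of_mem_starlikeClass hE' hD' hf hz)
      (injOn_of_mem_starlikeClass hE' hD' hf) ?_
    have hc : ContinuousAt (fun r : ℝ => ((-r * Real.exp (realExtremalLog D E (-r)) : ℝ) : ℂ)) 1 := by
      have h1 : ContinuousAt (realExtremalLog D E) (-1) :=
        (hasDerivAt_realExtremalLog (by linarith)).continuousAt
      have h2 : ContinuousAt (fun r : ℝ => realExtremalLog D E (-r)) 1 :=
        ContinuousAt.comp (g := realExtremalLog D E) (by simpa using h1) continuous_neg.continuousAt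
      exact continuous_ofReal.continuousAt.comp
        (continuous_neg.continuousAt.mul (Real.continuous_exp.continuousAt.comp h2))
    have ht := hc.tendsto.mono_left (nhdsWithin_le_nhds (s := Set.Iio 1))
    simp only [neg_mul, one_mul] at ht
    refine ht.congr' ?_
    filter_upwards [Ioo_mem_nhdsLT (show (0 : ℝ) < 1 by norm_num)] with r hr
    have := janowskiExtremal_ofReal (D := D) (x := -r) hE' (by rw [abs_neg, abs_of_pos hr.1]; exact hr.2)
    rw [ofReal_neg] at this
    rw [this, neg_mul]
  refine (infDist_le_dist_of_mem hfr).trans_eq ?_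
  rw [hf.1.2.1, dist_zero_left, norm_real, norm_neg, Real.norm_of_nonneg (extremalDist_pos D E).le]

/-- The derivative is `H(x) (1 + Dx)/(1 + Ex)`, and `1 + Dx ≥ 1 + Ex > 0` for `x ≥ 0`. The domain
goes beyond `[0, 1)` because uniqueness of the root is claimed wherever `1 + Er > 0`. -/
theorem janowskiExtremal_strictMonoOn {D E : ℝ} (hED : E < D) :
    StrictMonoOn (fun x => x * Real.exp (realExtremalLog D E x)) {x | 0 ≤ x ∧ 0 < 1 + E * x} := by
  have hder : ∀ x : ℝ, 0 < 1 + E * x → HasDerivAt (fun x => x * Real.exp (realExtremalLog D E x))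
      (Real.exp (realExtremalLog D E x) * ((1 + D * x) / (1 + E * x))) x := by
    intro x hx
    have h1 := (hasDerivAt_id x).fun_mul (hasDerivAt_realExtremalLog (D := D) hx).exp
    have h2 : (1 + D * x) / (1 + E * x) = 1 + x * ((D - E) / (1 + E * x)) := by
      rw [div_eq_iff hx.ne', add_mul, mul_assoc, div_mul_cancel₀ _ hx.ne']
      ring
    refine h1.congr_deriv ?_
    rw [h2]
    simp only [id]
    ring
  refine strictMonoOn_of_deriv_pos ?_ (fun x hx => (hder x hx.2).continuousAt.continuousWithinAt)
    fun x hx => ?_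
  · rw [convex_iff_ordConnected]
    refine ⟨fun x hx y hy z hz => ⟨hx.1.trans hz.1, ?_⟩⟩
    have hx2 := hx.2
    have hy2 := hy.2
    rcases le_or_gt 0 E with h | h
    · nlinarith [hx.1.trans hz.1]
    · nlinarith [hz.2]
  · obtain ⟨hx1, hx2⟩ := interior_subset hx
    rw [(hder x hx2).deriv]
    have : 0 < 1 + D * x := by nlinarith
    positivity

/-! ### The Bohr radius and its sharpness. -/

theorem exists_bohrRadius {D E : ℝ} (hE : -1 ≤ E) (hED : E < D)
    (h3 : extremalDist D E ≤ 1 / 3 * Real.exp (realExtremalLog D E (1 / 3))) :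
    ∃ r₀ : ℝ, 0 < r₀ ∧ r₀ ≤ 1 / 3 ∧ ∀ r : ℝ, 0 < 1 + E * r →
      (r * Real.exp (realExtremalLog D E r) = extremalDist D E ↔ r = r₀) := by
  have hpos : ∀ x ∈ Set.Icc (0 : ℝ) (1 / 3), 0 < 1 + E * x := fun x hx => by
    nlinarith [hx.1, hx.2]
  have hc : ContinuousOn (fun x => x * Real.exp (realExtremalLog D E x)) (Set.Icc 0 (1 / 3)) :=
    continuousOn_id.mul (Real.continuous_exp.comp_continuousOn fun x hx =>
      (hasDerivAt_realExtremalLog (hpos x hx)).continuousAt.continuousWithinAt)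
  have hδ := extremalDist_pos D E
  obtain ⟨r₀, hr, hr₀⟩ := intermediate_value_Icc (by norm_num) hc
    (show extremalDist D E ∈ _ by simpa using ⟨hδ.le, by simpa using h3⟩)
  simp only at hr₀
  have hr0 : 0 < r₀ := by
    refine hr.1.lt_of_ne ?_
    rintro rfl
    rw [zero_mul] at hr₀
    exact hδ.ne hr₀
  refine ⟨r₀, hr0, hr.2, fun r h => ⟨fun he => ?_, fun he => by rw [he, hr₀]⟩⟩
  have hr' : 0 < r := by
    by_contra! hle
    have := mul_nonpos_of_nonpos_of_nonneg hle (Real.exp_pos (realExtremalLog D E r)).le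
    linarith
  exact (janowskiExtremal_strictMonoOn hED).injOn ⟨hr'.le, h⟩ ⟨hr.1, hpos _ hr⟩ (he.trans hr₀.symm)

-- Nonnegativity in the complex order includes being real, so each coefficient equals its norm and
-- the majorant sums to `f₀(r)`.
open scoped ComplexOrder in
theorem majorant_janowskiExtremal {D E : ℝ} (hE : |E| ≤ 1)
    (ht : ∀ n : ℕ, 2 ≤ n → 0 ≤ taylorCoeff (janowskiExtremal D E) n) {r : ℝ} (h0 : 0 ≤ r)
    (h1 : r < 1) :
    majorant (janowskiExtremal D E) r = r * Real.exp (realExtremalLog D E r) := by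
  have hf := (janowskiExtremal_mem_starlikeClass (D := D) hE).1
  have hr : |r| < 1 := by rwa [abs_of_nonneg h0]
  have hs := hasSum_taylorCoeff hf.1 (z := (r : ℂ)) (by simpa using hr)
  rw [← hasSum_nat_add_iff' 1] at hs
  have hn : ∀ k, taylorCoeff (janowskiExtremal D E) (k + 1) =
      (‖taylorCoeff (janowskiExtremal D E) (k + 1)‖ : ℂ) := by
    rintro (_ | k)
    · simp [taylorCoeff, hf.2.2]
    · exact (norm_of_nonneg' (ht _ (by omega))).symm
  simp only [Finset.range_one, Finset.sum_singleton, taylorCoeff_zero, hf.2.1, zero_mul, sub_zero,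
    janowskiExtremal_ofReal hE hr] at hs
  rw [majorant]
  refine HasSum.tsum_eq ?_
  rw [← hasSum_ofReal]
  refine (hasSum_iff_of_forall_eq fun k => ?_).mp hs
  conv_lhs => rw [hn]
  push_cast
  rfl

theorem majorant_le_of_mem_subordinants {f g : ℂ → ℂ} (hf : DifferentiableOn ℂ f unitDisk)
    (hf0 : f 0 = 0) (hg : g ∈ subordinants f) {r : ℝ} (h0 : 0 ≤ r) (h1 : r ≤ 1 / 3) :
    majorant g r ≤ majorant f r := by
  obtain ⟨hgd, w, hw, hw0, hwm, hgw⟩ := hg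
  have h2 : r < 1 := by linarith
  have h := fullMajorant_comp_le hf hw hw0 hwm h0 h1
  rw [← fullMajorant_congr hgd hgw, fullMajorant_eq_norm_add_majorant hgd h0 h2,
    fullMajorant_eq_norm_add_majorant hf h0 h2, hgw 0 (by simp), hw0, hf0] at h
  simpa using h

/-- `f` need not be subordinate to `f₀`, but `f/z = H ∘ v` is subordinate to `H`; the factor `z`
only multiplies majorants by `r`. -/
theorem majorant_le_majorant_janowskiExtremal {D E : ℝ} (hE : |E| ≤ 1) {f : ℂ → ℂ}
    (hf : f ∈ starlikeClass (janowskiPsi D E)) {r : ℝ} (h0 : 0 ≤ r) (h1 : r ≤ 1 / 3) :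
    majorant f r ≤ majorant (janowskiExtremal D E) r := by
  obtain ⟨v, hv, hv0, hvm, hfv⟩ := exists_eq_mul_exp_extremalLog hE hf
  set H : ℂ → ℂ := fun z => exp (extremalLog D E z)
  have hH : DifferentiableOn ℂ H unitDisk := fun z hz =>
    (hasDerivAt_extremalLog hE hz).cexp.differentiableAt.differentiableWithinAt
  have hHv : DifferentiableOn ℂ (fun z => H (v z)) unitDisk := hH.comp hv hvm
  have e1 : majorant f r = r * fullMajorant (fun z => H (v z)) r := by
    rw [← majorant_mul_id hHv]
    simp only [majorant, taylorCoeff_congr hf.1.1 hfv, H]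
  have e2 : majorant (janowskiExtremal D E) r = r * fullMajorant H r := by
    rw [← majorant_mul_id hH]
    simp only [majorant, taylorCoeff_congr (janowskiExtremal_mem_starlikeClass (D := D) hE).1.1
      (fun z hz => janowskiExtremal_eq hE hz), H]
  rw [e1, e2]
  exact mul_le_mul_of_nonneg_left (fullMajorant_comp_le hH hv hv0 hvm h0 h1) h0

theorem mem_subordinants_self {f : ℂ → ℂ} (hf : DifferentiableOn ℂ f unitDisk) :
    f ∈ subordinants f :=
  ⟨hf, id, differentiableOn_id, rfl, fun _ hz => hz, fun _ _ => rfl⟩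

open scoped ComplexOrder in
theorem sharpBohr_janowski {D E : ℝ} (hE : -1 ≤ E) (hED : E < D) (hD : D ≤ 1)
    (ht : ∀ n : ℕ, 2 ≤ n → 0 ≤ taylorCoeff (janowskiExtremal D E) n) {r₀ : ℝ} (h0 : 0 < r₀)
    (h3 : r₀ ≤ 1 / 3) (hr₀ : r₀ * Real.exp (realExtremalLog D E r₀) = extremalDist D E) :
    SharpBohr (janowskiPsi D E) (janowskiExtremal D E) r₀ := by
  have hE' : |E| ≤ 1 := abs_le.2 ⟨hE, by linarith⟩
  have hmem := janowskiExtremal_mem_starlikeClass (D := D) hE'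
  have hmono : ∀ x y, 0 ≤ x → x < y → y < 1 →
      majorant (janowskiExtremal D E) x < majorant (janowskiExtremal D E) y := by
    intro x y hx hxy hy
    rw [majorant_janowskiExtremal hE' ht hx (hxy.trans hy),
      majorant_janowskiExtremal hE' ht (hx.trans hxy.le) hy]
    refine janowskiExtremal_strictMonoOn hED ⟨hx, ?_⟩ ⟨hx.trans hxy.le, ?_⟩ hxy <;>
      refine one_add_mul_pos hE' (abs_lt.2 ⟨?_, ?_⟩) <;> linarith
  have heq : majorant (janowskiExtremal D E) r₀ = boundaryDist (janowskiExtremal D E) := by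
    rw [majorant_janowskiExtremal hE' ht h0.le (by linarith), hr₀,
      boundaryDist_janowskiExtremal hE hED hD]
  have hfail : ∀ r ∈ Set.Ioo r₀ 1,
      boundaryDist (janowskiExtremal D E) < majorant (janowskiExtremal D E) r := fun r hr =>
    heq ▸ hmono r₀ r h0.le hr.1 hr.2
  have hbohr : ∀ f ∈ starlikeClass (janowskiPsi D E), BohrPhenomenon f (subordinants f) r₀ := by
    intro f hf g hg z hz hzr
    have hz' : ‖z‖ < 1 := by simpa using hz
    refine ⟨(summable_nat_add_iff 1).2 (summable_norm_taylorCoeff hg.1 (norm_nonneg z) hz'), ?_⟩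
    calc majorant g ‖z‖ ≤ majorant f ‖z‖ :=
          majorant_le_of_mem_subordinants hf.1.1 hf.1.2.1 hg (norm_nonneg z) (hzr.trans h3)
      _ ≤ majorant (janowskiExtremal D E) ‖z‖ :=
          majorant_le_majorant_janowskiExtremal hE' hf (norm_nonneg z) (hzr.trans h3)
      _ ≤ majorant (janowskiExtremal D E) r₀ := by
          rcases hzr.lt_or_eq with h | h
          · exact (hmono _ _ (norm_nonneg z) h (by linarith)).le
          · rw [h]
      _ = extremalDist D E := by rw [heq, boundaryDist_janowskiExtremal hE hED hD]
      _ ≤ boundaryDist f := extremalDist_le_boundaryDist hE hED hD hf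
  -- One test function bounds both radii, as `f₀` belongs to the class and is subordinate to itself.
  have hupper : ∀ ρ ∈ Set.Ioc (0 : ℝ) 1,
      BohrPhenomenon (janowskiExtremal D E) {janowskiExtremal D E} ρ → ρ ≤ r₀ := by
    intro ρ hρ hB
    by_contra! hlt
    obtain ⟨r, hr1, hr2⟩ := exists_between hlt
    have hr : |r| = r := abs_of_pos (h0.trans hr1)
    have := (hB _ rfl (r : ℂ) (by simpa [hr] using hr2.trans_le hρ.2)
      (by simpa [hr] using hr2.le)).2
    rw [norm_real, Real.norm_eq_abs, hr] at this
    exact absurd this (not_le.2 (hfail r ⟨hr1, hr2.trans_le hρ.2⟩))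
  have hr₀1 : r₀ ∈ Set.Ioc (0 : ℝ) 1 := ⟨h0, by linarith⟩
  refine ⟨⟨⟨hr₀1, hbohr⟩, fun ρ hρ => hupper ρ hρ.1 fun g hg => ?_⟩,
    ⟨⟨hr₀1, fun f hf g hg => ?_⟩, fun ρ hρ => hupper ρ hρ.1 (hρ.2 _ hmem)⟩, hmem, heq, hfail⟩
  · rw [Set.mem_singleton_iff.1 hg]
    exact hρ.2 _ hmem _ (mem_subordinants_self hmem.1.1)
  · rw [Set.mem_singleton_iff.1 hg]
    exact hbohr f hf f (mem_subordinants_self hf.1.1)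

theorem taylorCoeff_janowskiExtremal_zero (D : ℝ) (k : ℕ) :
    taylorCoeff (janowskiExtremal D 0) (k + 1) = ((D ^ k / k.factorial : ℝ) : ℂ) := by
  have hd : DifferentiableOn ℂ (fun z : ℂ => exp (D * z)) unitDisk :=
    (differentiable_id.const_mul (D : ℂ)).cexp.differentiableOn
  have e : janowskiExtremal D 0 = fun z => z * exp (D * z) := by
    ext z
    simp [janowskiExtremal]
  rw [e, taylorCoeff_mul_id_succ hd]
  refine taylorCoeff_eq_of_hasSum (c := fun k => ((D ^ k / k.factorial : ℝ) : ℂ)) hd one_pos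
    (fun z _ => ?_) k
  have := NormedSpace.expSeries_div_hasSum_exp ((D : ℂ) * z)
  rw [← exp_eq_exp_ℂ] at this
  refine (hasSum_iff_of_forall_eq fun k => ?_).mpr this
  push_cast
  ring

theorem rpow_eq_exp_realExtremalLog {D E x : ℝ} (h : E ≠ 0) (hx : 0 < 1 + E * x) :
    (1 + E * x) ^ ((D - E) / E) = Real.exp (realExtremalLog D E x) := by
  rw [realExtremalLog, if_neg h, Real.rpow_def_of_pos hx, mul_comm]

end JanowskiBohr

open JanowskiBohr in
open scoped ComplexOrder in
theorem mainTheorem10 (D E : ℝ) (hE : -1 ≤ E) (hED : E < D) (hD : D ≤ 1) :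
    (E = 0 → 3 / 4 * Real.log 3 ≤ D →
      ∃ r₀ ∈ Set.Ioo (0 : ℝ) 1,
        (∀ r : ℝ, 1 - r * Real.exp (D * (1 + r)) = 0 ↔ r = r₀) ∧
        SharpBohr (janowskiPsi D E) (janowskiExtremal D E) r₀) ∧
    (E ≠ 0 → (∀ n : ℕ, 2 ≤ n → 0 ≤ taylorCoeff (janowskiExtremal D E) n) →
      3 * (1 - E) ^ ((D - E) / E) ≤ (1 + E / 3) ^ ((D - E) / E) →
      ∃ r₀ ∈ Set.Ioo (0 : ℝ) 1,
        (∀ r : ℝ, 0 < 1 + E * r →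
          ((1 - E) ^ ((D - E) / E) - r * (1 + E * r) ^ ((D - E) / E) = 0 ↔ r = r₀)) ∧
        SharpBohr (janowskiPsi D E) (janowskiExtremal D E) r₀) := by
  constructor
  · rintro rfl hlog
    have hexp : ∀ r, realExtremalLog D 0 r = D * r := fun r => by simp [realExtremalLog]
    have hδ : extremalDist D 0 = Real.exp (-D) := by simp [extremalDist, hexp]
    obtain ⟨r₀, h0, h3, hr⟩ := exists_bohrRadius hE hED (by
      -- For `E = 0` the condition `-f₀(-1) ≤ f₀(1/3)` is `3 exp(-D) ≤ exp(D/3)`, that is `D ≥ (3/4)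
      -- log 3`.
      have h : Real.log 3 ≤ 4 / 3 * D := by linarith
      have h' : 3 ≤ Real.exp (4 / 3 * D) := (Real.log_le_iff_le_exp (by norm_num)).1 h
      rw [hδ, hexp, show D * (1 / 3) = 4 / 3 * D + -D by ring, Real.exp_add]
      nlinarith [Real.exp_pos (-D)])
    refine ⟨r₀, ⟨h0, by linarith⟩, fun r => ?_, sharpBohr_janowski hE hED hD (fun n hn => ?_) h0 h3
      ((hr r₀ (by simp)).2 rfl)⟩
    -- Multiplying `r exp(Dr) = exp(-D)` by `exp D` gives the stated equation.
    · rw [← hr r (by simp), hδ, hexp, mul_add, mul_one, Real.exp_add, Real.exp_neg,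
        ← mul_eq_one_iff_eq_inv₀ (Real.exp_ne_zero D), sub_eq_zero, eq_comm]
      ring_nf
    · obtain ⟨k, rfl⟩ : ∃ k, n = k + 1 := ⟨n - 1, by omega⟩
      rw [taylorCoeff_janowskiExtremal_zero, Complex.zero_le_real]
      positivity
  · intro hE0 ht h
    have hδ : (1 - E) ^ ((D - E) / E) = extremalDist D E := by
      rw [extremalDist, ← rpow_eq_exp_realExtremalLog hE0 (by linarith)]
      ring_nf
    obtain ⟨r₀, h0, h3, hr⟩ := exists_bohrRadius hE hED (by
      rw [← rpow_eq_exp_realExtremalLog hE0 (by linarith), ← hδ, mul_one_div]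
      linarith)
    refine ⟨r₀, ⟨h0, by linarith⟩, fun r hr' => ?_, sharpBohr_janowski hE hED hD ht h0 h3
      ((hr r₀ (by nlinarith)).2 rfl)⟩
    rw [hδ, rpow_eq_exp_realExtremalLog hE0 hr', ← hr r hr', sub_eq_zero, eq_comm]
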